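/- Let $K$ be an algebraically closed field of arbitrary characteristic, let $n\ge 2$, and identify $\mathbb G_m^n$ with the group $(K\setminus\{0\})^n$ with its Zariski topology, whose closed sets are the zero sets of Laurent polynomials in $K[X_1^{\pm1},\dots,X_n^{\pm1}]$. A *hypersurface* is the zero set in $\mathbb G_m^n$ of a Laurent polynomial that is neither zero nor a unit. A *linear torus* is an irreducible algebraic subgroup $G$ of $\mathbb G_m^n$, and a *torsion coset* is a set $\boldsymbol\zeta G$ with $\boldsymbol\zeta\in\mathbb G_m^n$ of finite order and $G$ a linear torus. An algebraic subset $X\subset\mathbb G_m^n$ of dimension $d$ is *admissible* if it is finite, or if $d\ge 1$ and $X$ contains no torsion coset of dimension $d$. For real $T\ge1$ let $X_T$ be the set of points of $X$ that have finite order at most $T$ in the group $\mathbb G_m^n$. If $X\subset\mathbb G_m^n$ is an admissible hypersurface, then there is a constant $c>0$, depending only on $X$, such that for all real $T\ge 1$ the set $X_T$ is finite and $$\#X_T\le c\,T^{\,n-1/n}.$$ -/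

import Mathlib

/-- The group `𝔾_m^n(K) = (K \ {0})^n` of `K`-points of the algebraic torus. -/
abbrev Torus (K : Type*) [Field K] (n : ℕ) : Type _ := Fin n → Kˣ

/-- The ring `K[X₁^{±1}, …, X_n^{±1}]` of Laurent polynomials in `n` variables, that is the
group algebra of `ℤ^n`. -/
abbrev LaurentRing (K : Type*) [Field K] (n : ℕ) : Type _ := AddMonoidAlgebra K (Fin n → ℤ)

namespace Torus

variable {K : Type*} [Field K] {n : ℕ}

/-- The monomial `x^a = x₁^{a₁} ⋯ x_n^{a_n}`, as a homomorphism in the exponent `a ∈ ℤ^n`. -/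
def monomialHom (x : Torus K n) : Multiplicative (Fin n → ℤ) →* K where
  toFun a := ((∏ i, x i ^ (Multiplicative.toAdd a i) : Kˣ) : K)
  map_one' := by simp
  map_mul' a b := by simp [zpow_add, Finset.prod_mul_distrib]

/-- The value `P(x) = ∑ p_a x^a` of a Laurent polynomial `P = ∑ p_a X^a` at the point `x`. -/
noncomputable def eval (x : Torus K n) : LaurentRing K n →ₐ[K] K :=
  AddMonoidAlgebra.lift K K (Fin n → ℤ) (monomialHom x)

/-- The zero locus `Z(P)` of a Laurent polynomial. -/
def zeroLocus (P : LaurentRing K n) : Set (Torus K n) := {x | eval x P = 0}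

/-- The common zero locus of a set of Laurent polynomials. -/
def commonZeros (S : Set (LaurentRing K n)) : Set (Torus K n) := {x | ∀ P ∈ S, eval x P = 0}

variable (K n) in
/-- The Zariski topology on `𝔾_m^n(K)`: the closed sets are the common zero loci of sets of
Laurent polynomials. -/
@[reducible] def zariski : TopologicalSpace (Torus K n) :=
  TopologicalSpace.ofClosed {X | ∃ S : Set (LaurentRing K n), X = commonZeros S}
    ⟨{1}, by ext x; simp [commonZeros]⟩
    (by
      intro A hA
      refine ⟨{P | ∃ X ∈ A, ∀ x ∈ X, eval x P = 0}, ?_⟩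
      ext x
      simp only [Set.mem_sInter, commonZeros, Set.mem_ofPred_eq]
      constructor
      · rintro h P ⟨X, hX, hP⟩
        exact hP x (h X hX)
      · intro h X hX
        obtain ⟨S, rfl⟩ := hA hX
        exact fun P hP => h P ⟨_, hX, fun y hy => hy P hP⟩)
    (by
      rintro _ ⟨S, rfl⟩ _ ⟨S', rfl⟩
      refine ⟨{R | ∃ P ∈ S, ∃ Q ∈ S', R = P * Q}, ?_⟩
      ext x
      simp only [Set.mem_union, commonZeros, Set.mem_ofPred_eq]
      constructor
      · rintro (h | h) _ ⟨P, hP, Q, hQ, rfl⟩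
        · rw [map_mul, h P hP, zero_mul]
        · rw [map_mul, h Q hQ, mul_zero]
      · intro h
        by_contra! hc
        obtain ⟨⟨P, hP, hPx⟩, Q, hQ, hQx⟩ := hc
        have := h _ ⟨P, hP, Q, hQ, rfl⟩
        rw [map_mul] at this
        exact (mul_ne_zero hPx hQx) this)

/-- An algebraic subset of the torus: the zero set of finitely many Laurent polynomials. -/
def IsAlgebraicSet (X : Set (Torus K n)) : Prop :=
  ∃ S : Finset (LaurentRing K n), X = commonZeros (S : Set (LaurentRing K n))

/-- The dimension of a subset of the torus: its Krull dimension in the Zariski topology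
(`⊥` for the empty set). -/
noncomputable def dim (X : Set (Torus K n)) : WithBot ℕ∞ :=
  @topologicalKrullDim X (@instTopologicalSpaceSubtype _ (· ∈ X) (zariski K n))

/-- A linear torus: an irreducible algebraic subgroup of `𝔾_m^n`. -/
def IsLinearTorus (G : Subgroup (Torus K n)) : Prop :=
  IsAlgebraicSet (G : Set (Torus K n)) ∧ @IsIrreducible _ (zariski K n) (G : Set (Torus K n))

/-- A torsion coset `ζG`, where `ζ` is a point of finite order and `G` is a linear torus. -/
def IsTorsionCoset (C : Set (Torus K n)) : Prop :=
  ∃ (ζ : Torus K n) (G : Subgroup (Torus K n)), IsOfFinOrder ζ ∧ IsLinearTorus G ∧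
    C = (fun g => ζ * g) '' (G : Set (Torus K n))

/-- An algebraic set `X` is admissible if it is finite, or if its dimension `d` is at least `1`
and it contains no torsion coset of dimension `d`. -/
def IsAdmissible (X : Set (Torus K n)) : Prop :=
  IsAlgebraicSet X ∧
    (X.Finite ∨ (1 ≤ dim X ∧ ∀ C : Set (Torus K n), IsTorsionCoset C → C ⊆ X → dim C ≠ dim X))

/-- A hypersurface: the zero locus of a Laurent polynomial that is neither zero nor a unit. -/
def IsHypersurface (X : Set (Torus K n)) : Prop :=
  ∃ P : LaurentRing K n, P ≠ 0 ∧ ¬ IsUnit P ∧ X = zeroLocus P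

/-- The set `X_T` of points of `X` of finite order at most `T`. -/
def torsionUpTo (X : Set (Torus K n)) (T : ℝ) : Set (Torus K n) :=
  {ζ ∈ X | IsOfFinOrder ζ ∧ (orderOf ζ : ℝ) ≤ T}

end Torus

/-! Points of the torus are treated as characters of a lattice `L` of rank `n`, and `X` as the zero
set of a finite system `S`; this form is stable under passing to quotient tori. Put `B =
⌊T^(1-1/n)⌋`.

A pigeonhole argument (`exists_eq_mul_cochar`) puts each torsion point of order at most `T` on a
curve `s ↦ η * cochar b s` with `η ^ g = 1`, `b ≠ 0` and all `g * |b(e i)| ≤ B`. If the curve is not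
inside `X`, it meets `X` in `O(B/g)` points, the degree in `s` of the equations. For fixed `g` there
are `O((B/g)^n)` forms `b`, and at most `g^(n-1)` curves for each, since `η` matters only modulo the
`g`-torsion of the curve's direction. Summing over `g` gives `O(B^(n+1) * ∑ 1/g^2)`, and
`(1-1/n)(n+1) = n-1/n` (`exists_ncard_off_slices_le`).

The other points lie in some `sliceLocus S b` with `b ≠ 0`. There are finitely many such loci
(`finite_range_sliceLocus`). For `b` primitive, each is the preimage of a zero set in the characters
of `ker b`, a torus of rank `n-1`, which again contains no torsion coset of codimension one. A point
of order `M` downstairs has at most `(T/M) * T` lifts of order at most `T` (`ncard_sliceLocus_le`).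
Induction on the rank and dyadic summation of `1/M` bound these points by `O(T^(n-1/(n-1)))`, which
is smaller than required.

Finally, a hypersurface has dimension at most `n-1` and a coset of codimension one at least `n-1`,
so an infinite admissible hypersurface contains no such torsion coset (`noTorsionCoset_of_dim_ne`).
-/

namespace CharTorus

/-! ### Characters, slices, and short curves through torsion points. -/

variable {K : Type*} [Field K] {L : Type*} [AddCommGroup L]

/-- The value `∑ p_a x(a)` of a finitely supported function `p` on a lattice at a character `x`. -/
noncomputable def charEval (x : AddChar L Kˣ) (P : L →₀ K) : K := ∑ a ∈ P.support, P a * x a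

/-- The characters at which all members of `S` vanish. -/
def vanishing (S : Finset (L →₀ K)) : Set (AddChar L Kˣ) := {x | ∀ P ∈ S, charEval x P = 0}

/-- The one-parameter subgroup `s ↦ (a ↦ s ^ b(a))` attached to a linear form `b`. -/
def cochar (b : L →ₗ[ℤ] ℤ) (s : Kˣ) : AddChar L Kˣ where
  toFun a := s ^ b a
  map_zero_eq_one' := by simp
  map_add_eq_mul' a a' := by simp [zpow_add]

@[simp] lemma cochar_apply (b : L →ₗ[ℤ] ℤ) (s : Kˣ) (a : L) : cochar b s a = s ^ b a := rfl

/-- The part of `∑ p_a x(a)` with `b(a) = m`. -/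
noncomputable def slice (b : L →ₗ[ℤ] ℤ) (x : AddChar L Kˣ) (P : L →₀ K) (m : ℤ) : K :=
  ∑ a ∈ P.support with b a = m, P a * x a

/-- The characters at which all `b`-homogeneous parts of all members of `S` vanish. -/
def sliceLocus (S : Finset (L →₀ K)) (b : L →ₗ[ℤ] ℤ) : Set (AddChar L Kˣ) :=
  {x | ∀ P ∈ S, ∀ m, slice b x P m = 0}

/-- Along the curve `x * cochar b s` the equation `P` is thus a Laurent polynomial in `s` whose
coefficients are the slices at `x`; in particular `sliceLocus` is stable under `cochar b`. -/
lemma slice_mul_cochar (b : L →ₗ[ℤ] ℤ) (x : AddChar L Kˣ) (s : Kˣ) (P : L →₀ K) (m : ℤ) :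
    slice b (x * cochar b s) P m = slice b x P m * ((s ^ m : Kˣ) : K) := by
  unfold slice
  rw [Finset.sum_mul]
  refine Finset.sum_congr rfl fun a ha => ?_
  rw [← (Finset.mem_filter.1 ha).2]
  simp [mul_assoc]

lemma charEval_eq_sum_slice (b : L →ₗ[ℤ] ℤ) (x : AddChar L Kˣ) (P : L →₀ K) :
    charEval x P = ∑ m ∈ P.support.image b, slice b x P m := by
  classical
  unfold charEval slice
  exact (Finset.sum_fiberwise_of_maps_to (fun a ha => Finset.mem_image_of_mem b ha) _).symm

lemma sliceLocus_subset_vanishing (S : Finset (L →₀ K)) (b : L →ₗ[ℤ] ℤ) :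
    sliceLocus S b ⊆ vanishing S := by
  intro x hx P hP
  rw [charEval_eq_sum_slice b]
  exact Finset.sum_eq_zero fun m _ => hx P hP m

lemma ext_basis {n : ℕ} (e : Module.Basis (Fin n) ℤ L) {x y : AddChar L Kˣ}
    (h : ∀ i, x (e i) = y (e i)) : x = y := by
  have : AddChar.toAddMonoidHom x = AddChar.toAddMonoidHom y := by
    have h2 : (AddChar.toAddMonoidHom x).toIntLinearMap = (AddChar.toAddMonoidHom y).toIntLinearMap :=
      e.ext fun i => by simpa using! congrArg Additive.ofMul (h i)
    ext a
    exact congrArg Additive.toMul (LinearMap.congr_fun h2 a) ▸ rfl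
  ext a
  exact congrArg (fun u : Kˣ => (u : K)) (congrArg Additive.toMul (DFunLike.congr_fun this a))

/-- The coordinates of a character killed by `g`, as roots of unity. -/
noncomputable def torsionCoord {n : ℕ} (e : Module.Basis (Fin n) ℤ L) (g : ℕ) :
    {x : AddChar L Kˣ // x ^ g = 1} → Fin n → rootsOfUnity g K :=
  fun x i => ⟨x.1 (e i), by
    rw [mem_rootsOfUnity, ← AddChar.pow_apply, x.2, AddChar.one_apply]⟩

lemma torsionCoord_injective {n : ℕ} (e : Module.Basis (Fin n) ℤ L) (g : ℕ) :
    Function.Injective (torsionCoord (K := K) e g) := fun _ _ h =>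
  Subtype.ext (ext_basis e fun i => congrArg Subtype.val (congrFun h i))

lemma finite_torsion {n : ℕ} (e : Module.Basis (Fin n) ℤ L) (g : ℕ) [NeZero g] :
    Finite {x : AddChar L Kˣ // x ^ g = 1} :=
  Finite.of_injective _ (torsionCoord_injective e g)

lemma card_torsion_le {n : ℕ} (e : Module.Basis (Fin n) ℤ L) (g : ℕ) [NeZero g] :
    Nat.card {x : AddChar L Kˣ // x ^ g = 1} ≤ Nat.card (rootsOfUnity g K) ^ n := by
  refine (Nat.card_le_card_of_injective _ (torsionCoord_injective e g)).trans ?_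
  simp [Nat.card_fun]

/-- A short one-parameter subgroup through a torsion point, up to small torsion. -/
theorem exists_eq_mul_cochar {n : ℕ} (e : Module.Basis (Fin n) ℤ L) (ζ : AddChar L Kˣ)
    (hζ : IsOfFinOrder ζ) (hn : 1 ≤ n) (B : ℕ) (hB : orderOf ζ ^ (n - 1) < (B + 1) ^ n) :
    ∃ (g : ℕ) (b : L →ₗ[ℤ] ℤ) (η : AddChar L Kˣ) (s : Kˣ), 0 < g ∧ b ≠ 0 ∧ η ^ g = 1 ∧
      ζ = η * cochar b s ∧ ∀ i, g * (b (e i)).natAbs ≤ B := by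
  set N := orderOf ζ with hN
  have hNpos : 0 < N := hζ.orderOf_pos
  have : NeZero N := ⟨hNpos.ne'⟩
  set z : Fin n → rootsOfUnity N K := torsionCoord e N ⟨ζ, pow_orderOf_eq_one ζ⟩ with hz
  have hzζ : ∀ i, ((z i : rootsOfUnity N K) : Kˣ) = ζ (e i) := fun i => rfl
  have hzord : orderOf z = N := by
    refine Eq.trans (orderOf_eq_orderOf_iff.2 fun k => ?_) hN.symm
    constructor
    · intro h
      refine ext_basis e fun i => ?_
      rw [AddChar.pow_apply, AddChar.one_apply, ← hzζ]
      simpa using congrArg Subtype.val (congrFun h i)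
    · intro h
      funext i
      apply Subtype.ext
      simp [hzζ, ← AddChar.pow_apply, h]
  obtain ⟨ω, hω⟩ := IsCyclic.exists_generator (α := rootsOfUnity N K)
  -- The group of `N`-th roots of unity could be smaller in positive characteristic, but its
  -- exponent is a multiple of the order `N` of `z`.
  have hcard : Nat.card (rootsOfUnity N K) = N := by
    refine le_antisymm (card_rootsOfUnity K N) ?_
    refine Nat.le_of_dvd Nat.card_pos ?_
    have h : orderOf z ∣ Nat.card (rootsOfUnity N K) :=
      orderOf_dvd_of_pow_eq_one (funext fun i => pow_card_eq_one')
    rwa [hzord] at h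
  have hωord : orderOf ω = N := by rw [orderOf_eq_card_of_forall_mem_zpowers hω, hcard]
  -- Pigeonhole: `(B + 1) ^ n` exponent vectors against `N ^ (n - 1)` cosets of the cyclic group
  -- generated by `z`.
  let f : (Fin n → Fin (B + 1)) → (Fin n → rootsOfUnity N K) ⧸ Subgroup.zpowers z :=
    fun v => QuotientGroup.mk fun i => ω ^ (v i : ℕ)
  have hquot : Nat.card ((Fin n → rootsOfUnity N K) ⧸ Subgroup.zpowers z) = N ^ (n - 1) := by
    have h := Subgroup.card_eq_card_quotient_mul_card_subgroup (Subgroup.zpowers z)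
    rw [Nat.card_fun, hcard, Nat.card_zpowers, hzord, Nat.card_eq_fintype_card, Fintype.card_fin] at h
    have h3 : N ^ n = N ^ (n - 1) * N := by rw [← pow_succ]; congr 1; omega
    exact Nat.eq_of_mul_eq_mul_right hNpos (h.symm.trans h3)
  have hninj : ¬ Function.Injective f := by
    intro hf
    have h := Nat.card_le_card_of_injective f hf
    rw [hquot, Nat.card_fun, Nat.card_eq_fintype_card, Nat.card_eq_fintype_card, Fintype.card_fin,
      Fintype.card_fin] at h
    omega
  simp only [Function.Injective, not_forall] at hninj
  obtain ⟨v, w, hvw, hne⟩ := hninj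
  obtain ⟨t, ht⟩ := Subgroup.mem_zpowers_iff.1 (QuotientGroup.eq.1 hvw)
  let β : Fin n → ℤ := fun i => (w i : ℤ) - (v i : ℤ)
  have hβ : ∀ i, ω ^ β i = (z i) ^ t := by
    intro i
    have := congrFun ht i
    simp only [Pi.pow_apply, Pi.mul_apply, Pi.inv_apply] at this
    rw [this, ← zpow_natCast, ← zpow_natCast, ← zpow_neg, ← zpow_add]
    congr 1
    simp only [β]; ring
  have hβB : ∀ i, (β i).natAbs ≤ B := by
    intro i
    have h1 := (w i).2
    have h2 := (v i).2
    simp only [β]; omega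
  have hβne : ∃ i, β i ≠ 0 := by
    by_contra! h
    apply hne
    funext i
    have := h i
    apply Fin.ext
    simp only [β] at this; omega
  set g := Int.gcd t N with hg
  have hgpos : 0 < g := Int.gcd_pos_of_ne_zero_right _ (by exact_mod_cast hNpos.ne')
  -- Raising `ω ^ β i = z i ^ t` to the power `N / g` makes the right side trivial, because `N`
  -- divides `t * (N / g)`.
  have hgβ : ∀ i, (g : ℤ) ∣ β i := by
    intro i
    obtain ⟨N', hN'⟩ : (g : ℤ) ∣ N := Int.gcd_dvd_right ..
    obtain ⟨t', ht'⟩ : (g : ℤ) ∣ t := Int.gcd_dvd_left ..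
    have h1 : ω ^ (β i * N') = 1 := by
      rw [zpow_mul, hβ, ← zpow_mul, show t * N' = N * t' by rw [ht', hN']; ring, zpow_mul,
        zpow_natCast]
      have : z i ^ N = 1 := by
        have := congrFun (pow_orderOf_eq_one z) i
        rwa [hzord] at this
      rw [this, one_zpow]
    have h2 : (N : ℤ) ∣ β i * N' := by
      rw [← hωord]; exact orderOf_dvd_iff_zpow_eq_one.2 h1
    have hN'0 : N' ≠ 0 := by
      rintro rfl
      rw [mul_zero] at hN'
      exact hNpos.ne' (by exact_mod_cast hN')
    rw [hN'] at h2
    exact Int.dvd_of_mul_dvd_mul_right hN'0 h2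
  choose β' hβ' using hgβ
  -- Bézout gives `ζ ^ g = (ζ ^ t) ^ x = ω ^ (β * x)`. With `s = ω ^ x` and `β = g * β'` the
  -- quotient of `ζ` by `cochar b s` is therefore killed by `g`.
  set x := Int.gcdA t N
  have hbez : (g : ℤ) = t * x + N * Int.gcdB t N := Int.gcd_eq_gcd_ab t N
  let b : L →ₗ[ℤ] ℤ := e.constr ℤ β'
  have hbe : ∀ i, b (e i) = β' i := fun i => e.constr_basis ℤ β' i
  let s : Kˣ := ((ω ^ x : rootsOfUnity N K) : Kˣ)
  have hζN : ∀ i, ζ (e i) ^ (N : ℤ) = 1 := by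
    intro i
    rw [zpow_natCast, ← AddChar.pow_apply, hN, pow_orderOf_eq_one, AddChar.one_apply]
  refine ⟨g, b, ζ * (cochar b s)⁻¹, s, hgpos, ?_, ?_, by simp, ?_⟩
  · intro hb
    obtain ⟨i, hi⟩ := hβne
    apply hi
    rw [hβ', ← hbe, hb]; simp
  · refine ext_basis e fun i => ?_
    have h1 : ζ (e i) ^ g = s ^ (β i) := by
      rw [← zpow_natCast, hbez, zpow_add, zpow_mul, zpow_mul, hζN, one_zpow, mul_one]
      have := congrArg Subtype.val (hβ i)
      push_cast at this
      rw [hzζ] at this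
      rw [← this]
      simp only [s]
      push_cast
      rw [← zpow_mul, ← zpow_mul, mul_comm]
    rw [AddChar.pow_apply, AddChar.mul_apply, AddChar.inv_apply', cochar_apply, hbe, mul_pow, h1,
      hβ', AddChar.one_apply, inv_pow, ← zpow_natCast (s ^ β' i), ← zpow_mul, mul_comm (g : ℤ)]
    simp
  · intro i
    have := hβB i
    rw [hβ', Int.natAbs_mul, Int.natAbs_natCast] at this
    rwa [hbe]

end CharTorus

/-! ### Counting torsion zeros on curves not contained in the zero set. -/

namespace CharTorus

variable {K : Type*} [Field K] {L : Type*} [AddCommGroup L]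

/-- If `η` is in the slice locus, so is the whole curve and nothing is counted. Otherwise some
equation restricts to a nonzero Laurent polynomial in `s` with exponents in `[-H, H]`; multiplied by
`s ^ H` it has at most `2 * H` roots. -/
lemma finite_and_card_cochar_le (S : Finset (L →₀ K)) (b : L →ₗ[ℤ] ℤ) (H : ℕ)
    (hH : ∀ P ∈ S, ∀ a ∈ P.support, (b a).natAbs ≤ H) (η : AddChar L Kˣ) :
    Finite {s : Kˣ // η * cochar b s ∈ vanishing S \ sliceLocus S b} ∧
      Nat.card {s : Kˣ // η * cochar b s ∈ vanishing S \ sliceLocus S b} ≤ 2 * H := by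
  classical
  by_cases hη : η ∈ sliceLocus S b
  · have : IsEmpty {s : Kˣ // η * cochar b s ∈ vanishing S \ sliceLocus S b} := by
      refine ⟨fun s => s.2.2 fun P hP m => ?_⟩
      rw [slice_mul_cochar, hη P hP m, zero_mul]
    exact ⟨inferInstance, by rw [Nat.card_of_isEmpty]; exact Nat.zero_le _⟩
  simp only [sliceLocus, Set.mem_ofPred_eq, not_forall] at hη
  obtain ⟨P, hP, m, hm⟩ := hη
  let Q : Polynomial K := ∑ a ∈ P.support, Polynomial.C (P a * η a) * Polynomial.X ^ (b a + H).toNat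
  have hdeg : Q.natDegree ≤ 2 * H := by
    refine Polynomial.natDegree_sum_le_of_forall_le _ _ fun a ha => ?_
    refine (Polynomial.natDegree_C_mul_X_pow_le _ _).trans ?_
    have := hH P hP a ha
    omega
  have hQ : Q ≠ 0 := by
    intro h0
    apply hm
    have hcoeff : Q.coeff (m + H).toNat = slice b η P m := by
      by_cases hmH : m.natAbs ≤ H
      · simp only [Q, Polynomial.finsetSum_coeff, Polynomial.coeff_C_mul_X_pow, slice,
          Finset.sum_filter]
        refine Finset.sum_congr rfl fun a ha => ?_
        have := hH P hP a ha
        congr 1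
        apply propext
        omega
      · exfalso
        apply hm
        unfold slice
        refine Finset.sum_eq_zero fun a ha => ?_
        rw [Finset.mem_filter] at ha
        have := hH P hP a ha.1
        rw [ha.2] at this
        exact absurd this hmH
    rw [← hcoeff, h0, Polynomial.coeff_zero]
  have hroot : ∀ s : {s : Kˣ // η * cochar b s ∈ vanishing S \ sliceLocus S b},
      ((s : Kˣ) : K) ∈ Q.roots.toFinset := by
    rintro ⟨s, hs⟩
    rw [Multiset.mem_toFinset, Polynomial.mem_roots hQ, Polynomial.IsRoot.def]
    have h1 : charEval (η * cochar b s) P = 0 := hs.1 P hP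
    have h2 : Q.eval (s : K) = (s : K) ^ H * charEval (η * cochar b s) P := by
      simp only [Q, Polynomial.eval_finsetSum, charEval, Finset.mul_sum]
      refine Finset.sum_congr rfl fun a ha => ?_
      have := hH P hP a ha
      have h3 : (s : K) ^ (b a + H).toNat = ((s ^ (b a) : Kˣ) : K) * (s : K) ^ H := by
        rw [← Units.val_pow_eq_pow_val, ← Units.val_pow_eq_pow_val, ← Units.val_mul, ← zpow_natCast,
          ← zpow_natCast s H, ← zpow_add, Int.toNat_of_nonneg (by omega)]
      simp only [Polynomial.eval_mul, Polynomial.eval_C, Polynomial.eval_pow, Polynomial.eval_X, h3,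
        AddChar.mul_apply, cochar_apply, Units.val_mul]
      ring
    rw [h2, h1, mul_zero]
  let F : {s : Kˣ // η * cochar b s ∈ vanishing S \ sliceLocus S b} → Q.roots.toFinset :=
    fun s => ⟨_, hroot s⟩
  have hF : Function.Injective F := fun s t h =>
    Subtype.ext (Units.ext (congrArg Subtype.val h))
  refine ⟨Finite.of_injective F hF, (Nat.card_le_card_of_injective F hF).trans ?_⟩
  rw [Nat.card_eq_fintype_card, Fintype.card_coe]
  exact (Multiset.toFinset_card_le _).trans ((Polynomial.card_roots' Q).trans hdeg)

/-- The zeros of `S` of the form `η * cochar b s` with `η` of order dividing `g`, for which the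
curve `η * cochar b` is not contained in the zero set of `S`. -/
def offSlice (S : Finset (L →₀ K)) (g : ℕ) (b : L →ₗ[ℤ] ℤ) : Set (AddChar L Kˣ) :=
  {ζ | ζ ∈ vanishing S \ sliceLocus S b ∧ ∃ (η : AddChar L Kˣ) (s : Kˣ), η ^ g = 1 ∧
    ζ = η * cochar b s}

theorem finite_and_card_offSlice_le {n : ℕ} (hn : 1 ≤ n) (e : Module.Basis (Fin n) ℤ L)
    (S : Finset (L →₀ K)) (g : ℕ) (hg : 0 < g) (b : L →ₗ[ℤ] ℤ) (H : ℕ)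
    (hH : ∀ P ∈ S, ∀ a ∈ P.support, (b a).natAbs ≤ H) :
    (offSlice S g b).Finite ∧ (offSlice S g b).ncard ≤ g ^ (n - 1) * (2 * H) := by
  classical
  have : NeZero g := ⟨hg.ne'⟩
  have := finite_torsion (K := K) e g
  have := Fintype.ofFinite {x : AddChar L Kˣ // x ^ g = 1}
  have hfin := fun η => (finite_and_card_cochar_le S b H hH η).1
  have hroots := fun η => (finite_and_card_cochar_le S b H hH η).2
  have hdec : ∀ ζ : offSlice S g b, ∃ p : AddChar L Kˣ × Kˣ, p.1 ^ g = 1 ∧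
      (ζ : AddChar L Kˣ) = p.1 * cochar b p.2 := fun ζ => by
    obtain ⟨η, s, h⟩ := ζ.2.2
    exact ⟨(η, s), h⟩
  choose p hp1 hp2 using hdec
  have hmul : ∀ (s t : Kˣ), cochar b (s * t) = cochar b s * cochar b t := by
    intro s t
    ext a
    simp [mul_zpow]
  have hinv : ∀ (s : Kˣ), cochar b (s⁻¹) = (cochar b s)⁻¹ := by
    intro s
    ext a
    simp
  have hpow : ∀ (s : Kˣ) (k : ℕ), cochar b s ^ k = cochar b (s ^ k) := by
    intro s k
    ext a
    rw [AddChar.pow_apply, cochar_apply, cochar_apply, ← zpow_natCast, ← zpow_natCast s,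
      ← zpow_mul, ← zpow_mul, mul_comm]
  have hone : cochar b (1 : Kˣ) = 1 := by
    ext a
    simp
  -- Double counting: moving a `g`-th root of unity from `s` to `η` does not change the point, so
  -- each point has at least `m` parametrizations, `m` being the number of `g`-th roots of unity in
  -- `K`. This turns the factor `m ^ n` for `η` into `m ^ (n - 1)`.
  let Φ : offSlice S g b × rootsOfUnity g K → Σ η : {x : AddChar L Kˣ // x ^ g = 1},
      {s : Kˣ // η.1 * cochar b s ∈ vanishing S \ sliceLocus S b} :=
    fun q => ⟨⟨(p q.1).1 * cochar b ((q.2 : Kˣ)⁻¹), by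
        rw [mul_pow, hp1, hpow, inv_pow, (mem_rootsOfUnity g _).1 q.2.2, inv_one, hone]
        exact one_mul (1 : AddChar L Kˣ)⟩,
      ⟨(p q.1).2 * (q.2 : Kˣ), by
        have : (p q.1).1 * cochar b ((q.2 : Kˣ)⁻¹) * cochar b ((p q.1).2 * (q.2 : Kˣ)) =
            (q.1 : AddChar L Kˣ) := by
          rw [hp2 q.1, hmul, hinv, mul_assoc, mul_comm (cochar b (p q.1).2), inv_mul_cancel_left]
        rw [this]
        exact q.1.2.1⟩⟩
  have hprod : ∀ q, (Φ q).1.1 * cochar b (Φ q).2.1 = (q.1 : AddChar L Kˣ) := by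
    intro q
    simp only [Φ]
    rw [hp2 q.1, hmul, hinv, mul_assoc, mul_comm (cochar b (p q.1).2), inv_mul_cancel_left]
  have hs : ∀ q, (Φ q).2.1 = (p q.1).2 * (q.2 : Kˣ) := fun q => rfl
  have hΦ : Function.Injective Φ := by
    intro q q' h
    have h1 : q.1 = q'.1 := Subtype.ext (by rw [← hprod q, ← hprod q', h])
    have h2 : (p q.1).2 * (q.2 : Kˣ) = (p q'.1).2 * (q'.2 : Kˣ) := by rw [← hs, ← hs, h]
    rw [h1] at h2
    exact Prod.ext h1 (Subtype.ext (mul_left_cancel h2))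
  have hfinprod : Finite (offSlice S g b × rootsOfUnity g K) := Finite.of_injective Φ hΦ
  have hfinG : Finite (offSlice S g b) := Finite.of_injective (fun ζ => ((ζ, 1) :
    offSlice S g b × rootsOfUnity g K)) fun ζ ζ' h => congrArg Prod.fst h
  refine ⟨Set.toFinite _, ?_⟩
  rw [← Nat.card_coe_set_eq]
  set m := Nat.card (rootsOfUnity g K) with hm
  have hmpos : 0 < m := Nat.card_pos
  have hle := Nat.card_le_card_of_injective Φ hΦ
  rw [Nat.card_prod, Nat.card_sigma] at hle
  have hsum : ∑ η : {x : AddChar L Kˣ // x ^ g = 1},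
      Nat.card {s : Kˣ // η.1 * cochar b s ∈ vanishing S \ sliceLocus S b} ≤ m ^ n * (2 * H) := by
    refine (Finset.sum_le_card_nsmul _ _ (2 * H) fun η _ => hroots η.1).trans ?_
    rw [smul_eq_mul, Finset.card_univ, ← Nat.card_eq_fintype_card]
    exact Nat.mul_le_mul_right _ (card_torsion_le e g)
  have hmn : m ^ n = m ^ (n - 1) * m := by rw [← pow_succ]; congr 1; omega
  have h2 : Nat.card (offSlice S g b) * m ≤ (m ^ (n - 1) * (2 * H)) * m := by
    refine hle.trans (hsum.trans ?_)
    rw [hmn]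
    exact le_of_eq (by ring)
  refine (Nat.le_of_mul_le_mul_right h2 hmpos).trans ?_
  exact Nat.mul_le_mul_right _ (Nat.pow_le_pow_left (card_rootsOfUnity K g) _)

/-- The points of `X` of finite order at most `T`. -/
def torsionZeros (X : Set (AddChar L Kˣ)) (T : ℕ) : Set (AddChar L Kˣ) :=
  {ζ ∈ X | IsOfFinOrder ζ ∧ orderOf ζ ≤ T}

lemma natAbs_apply_le {n : ℕ} (e : Module.Basis (Fin n) ℤ L) (b : L →ₗ[ℤ] ℤ) (k : ℕ)
    (hb : ∀ i, (b (e i)).natAbs ≤ k) (a : L) :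
    (b a).natAbs ≤ (∑ i, (e.repr a i).natAbs) * k := by
  conv_lhs => rw [← e.sum_repr a, map_sum]
  refine (Int.natAbs_sum_le _ _).trans ?_
  rw [Finset.sum_mul]
  refine Finset.sum_le_sum fun i _ => ?_
  rw [map_smul, smul_eq_mul, Int.natAbs_mul]
  exact Nat.mul_le_mul_left _ (hb i)

/-- The factors count the forms `b` with coordinates at most `B / g`, the curves for each, and the
zeros on each curve. As `g ≤ B` gives `B / g ≥ 1`, the first is at most `(3 * B / g) ^ n`, and each
term is `O(B ^ (n + 1) / g ^ 2)`. -/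
lemma sum_box_le {n : ℕ} (hn : 1 ≤ n) (A B : ℕ) :
    ((∑ g ∈ Finset.Icc 1 B, (2 * (B / g) + 1) ^ n * (g ^ (n - 1) * (2 * (A * (B / g)))) : ℕ) : ℝ) ≤
      (2 * A * 3 ^ n * ∑' g : ℕ, 1 / (g : ℝ) ^ 2) * (B : ℝ) ^ (n + 1) := by
  have hsum : Summable fun g : ℕ => 1 / (g : ℝ) ^ 2 :=
    Real.summable_one_div_nat_pow.2 (by norm_num)
  have h1 : ∑ g ∈ Finset.Icc 1 B, 1 / (g : ℝ) ^ 2 ≤ ∑' g : ℕ, 1 / (g : ℝ) ^ 2 :=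
    hsum.sum_le_tsum _ fun g _ => by positivity
  have h2 : ((∑ g ∈ Finset.Icc 1 B, (2 * (B / g) + 1) ^ n *
      (g ^ (n - 1) * (2 * (A * (B / g)))) : ℕ) : ℝ) ≤
      ∑ g ∈ Finset.Icc 1 B, (2 * A * 3 ^ n * (B : ℝ) ^ (n + 1)) * (1 / (g : ℝ) ^ 2) := by
    push_cast
    refine Finset.sum_le_sum fun g hg => ?_
    rw [Finset.mem_Icc] at hg
    have hg0 : (0 : ℝ) < g := by exact_mod_cast hg.1
    have h3 : ((B / g : ℕ) : ℝ) ≤ B / g := Nat.cast_div_le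
    have h4 : (1 : ℝ) ≤ ((B / g : ℕ) : ℝ) := by
      exact_mod_cast (Nat.one_le_div_iff (by omega)).2 hg.2
    have h5 : (2 * ((B / g : ℕ) : ℝ) + 1) ≤ 3 * (B / g) := by linarith
    calc (2 * ((B / g : ℕ) : ℝ) + 1) ^ n * ((g : ℝ) ^ (n - 1) * (2 * (A * ((B / g : ℕ) : ℝ))))
        ≤ (3 * (B / g)) ^ n * ((g : ℝ) ^ (n - 1) * (2 * (A * (B / g)))) := by gcongr
      _ = (2 * A * 3 ^ n * (B : ℝ) ^ (n + 1)) * (1 / (g : ℝ) ^ 2) := by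
        obtain ⟨k, rfl⟩ : ∃ k, n = k + 1 := ⟨n - 1, by omega⟩
        simp only [Nat.add_sub_cancel, mul_pow, div_pow]
        field_simp
        ring
  refine h2.trans ?_
  rw [← Finset.mul_sum, mul_right_comm]
  gcongr

/-- This `B` satisfies the pigeonhole condition for all orders up to `T`. -/
lemma lt_floor_rpow_add_one_pow {n : ℕ} (hn : 1 ≤ n) (T : ℕ) :
    T ^ (n - 1) < (⌊(T : ℝ) ^ (1 - 1 / (n : ℝ))⌋₊ + 1) ^ n := by
  have hn0 : (n : ℝ) ≠ 0 := by exact_mod_cast (by omega : n ≠ 0)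
  have h : ((T : ℝ) ^ (1 - 1 / (n : ℝ))) ^ n = (T : ℝ) ^ (n - 1) := by
    rw [← Real.rpow_natCast, ← Real.rpow_mul (by positivity), ← Real.rpow_natCast, Nat.cast_sub hn]
    congr 1
    field_simp
    simp
  have h2 : (T : ℝ) ^ (n - 1) < ((⌊(T : ℝ) ^ (1 - 1 / (n : ℝ))⌋₊ : ℝ) + 1) ^ n := by
    rw [← h]
    exact pow_lt_pow_left₀ (Nat.lt_floor_add_one _) (by positivity) (by omega)
  exact_mod_cast h2

lemma floor_rpow_pow_le {n : ℕ} (hn : 1 ≤ n) (T : ℕ) :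
    (⌊(T : ℝ) ^ (1 - 1 / (n : ℝ))⌋₊ : ℝ) ^ (n + 1) ≤ (T : ℝ) ^ ((n : ℝ) - 1 / n) := by
  have hn0 : (n : ℝ) ≠ 0 := by exact_mod_cast (by omega : n ≠ 0)
  refine (pow_le_pow_left₀ (by positivity) (Nat.floor_le (by positivity)) _).trans (le_of_eq ?_)
  rw [← Real.rpow_natCast, ← Real.rpow_mul (by positivity)]
  congr 1
  push_cast
  field_simp
  ring

/-- Torsion zeros that lie on no one-parameter torsion coset of zeros are few. -/
theorem exists_ncard_off_slices_le {n : ℕ} (hn : 1 ≤ n) (e : Module.Basis (Fin n) ℤ L)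
    (S : Finset (L →₀ K)) :
    ∃ c : ℝ, ∀ T : ℕ,
      ((torsionZeros (vanishing S \ ⋃ b ≠ 0, sliceLocus S b) T).ncard : ℝ) ≤
        c * (T : ℝ) ^ ((n : ℝ) - 1 / n) := by
  classical
  -- A bound for the `ℓ¹` norm, in the basis `e`, of every exponent occurring in `S`.
  let A : ℕ := ∑ P ∈ S, ∑ a ∈ P.support, ∑ i, (e.repr a i).natAbs
  have hA : ∀ P ∈ S, ∀ a ∈ P.support, ∑ i, (e.repr a i).natAbs ≤ A := by
    intro P hP a ha
    exact (Finset.single_le_sum (f := fun a => ∑ i, (e.repr a i).natAbs) (by simp) ha).trans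
      (Finset.single_le_sum (f := fun P : L →₀ K => ∑ a ∈ P.support, ∑ i, (e.repr a i).natAbs)
        (by simp) hP)
  refine ⟨2 * A * 3 ^ n * ∑' g : ℕ, 1 / (g : ℝ) ^ 2, fun T => ?_⟩
  set B := ⌊(T : ℝ) ^ (1 - 1 / (n : ℝ))⌋₊ with hBdef
  let box : ℕ → Finset (Fin n → ℤ) := fun k => Fintype.piFinset fun _ => Finset.Icc (-(k : ℤ)) k
  have hbox : ∀ k v, v ∈ box k ↔ ∀ i, (v i).natAbs ≤ k := by
    intro k v
    simp only [box, Fintype.mem_piFinset, Finset.mem_Icc]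
    exact forall_congr' fun i => by omega
  have hboxcard : ∀ k, (box k).card = (2 * k + 1) ^ n := by
    intro k
    simp only [box, Fintype.card_piFinset_const, Int.card_Icc]
    congr 1
    omega
  have hpt : ∀ g ∈ Finset.Icc 1 B, ∀ v ∈ box (B / g),
      (offSlice S g (e.constr ℤ v)).Finite ∧
        (offSlice S g (e.constr ℤ v)).ncard ≤ g ^ (n - 1) * (2 * (A * (B / g))) := by
    intro g hg v hv
    refine finite_and_card_offSlice_le hn e S g (Finset.mem_Icc.1 hg).1 _ _ fun P hP a ha => ?_
    refine (natAbs_apply_le e _ (B / g) (fun i => ?_) a).trans (Nat.mul_le_mul_right _ (hA P hP a ha))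
    rw [e.constr_basis]
    exact (hbox _ _).1 hv i
  have hsub : torsionZeros (vanishing S \ ⋃ b ≠ 0, sliceLocus S b) T ⊆
      ⋃ g ∈ Finset.Icc 1 B, ⋃ v ∈ box (B / g), offSlice S g (e.constr ℤ v) := by
    rintro ζ ⟨⟨hζS, hζb⟩, hζfin, hζT⟩
    obtain ⟨g, b, η, s, hg, hb, hη, hζ, hbB⟩ := exists_eq_mul_cochar e ζ hζfin hn B
      ((Nat.pow_le_pow_left hζT _).trans_lt (lt_floor_rpow_add_one_pow hn T))
    have hbv : e.constr ℤ (fun i => b (e i)) = b := e.ext fun i => by simp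
    -- Some coordinate of `b` is a nonzero integer, so `g` itself is bounded by `B`.
    have hgB : g ≤ B := by
      obtain ⟨i, hi⟩ : ∃ i, b (e i) ≠ 0 := by
        by_contra! h
        exact hb (e.ext fun i => by simp [h i])
      exact (Nat.le_mul_of_pos_right g (Int.natAbs_pos.2 hi)).trans (hbB i)
    simp only [Set.mem_iUnion]
    refine ⟨g, Finset.mem_Icc.2 ⟨hg, hgB⟩, fun i => b (e i), ?_, ?_⟩
    · rw [hbox]
      intro i
      rw [Nat.le_div_iff_mul_le hg, mul_comm]
      exact hbB i
    · rw [hbv]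
      refine ⟨⟨hζS, fun h => hζb ?_⟩, η, s, hη, hζ⟩
      simp only [Set.mem_iUnion]
      exact ⟨b, hb, h⟩
  have hfin : (⋃ g ∈ Finset.Icc 1 B, ⋃ v ∈ box (B / g), offSlice S g (e.constr ℤ v)).Finite :=
    (Finset.finite_toSet _).biUnion fun g hg => (Finset.finite_toSet _).biUnion
      fun v hv => (hpt g hg v hv).1
  have hcard : (torsionZeros (vanishing S \ ⋃ b ≠ 0, sliceLocus S b) T).ncard ≤
      ∑ g ∈ Finset.Icc 1 B, (2 * (B / g) + 1) ^ n * (g ^ (n - 1) * (2 * (A * (B / g)))) := by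
    refine (Set.ncard_le_ncard hsub hfin).trans ?_
    refine (Finset.set_ncard_biUnion_le _ _).trans (Finset.sum_le_sum fun g hg => ?_)
    refine (Finset.set_ncard_biUnion_le _ _).trans ?_
    refine (Finset.sum_le_card_nsmul _ _ _ fun v hv => (hpt g hg v hv).2).trans ?_
    rw [smul_eq_mul, hboxcard]
  calc ((torsionZeros (vanishing S \ ⋃ b ≠ 0, sliceLocus S b) T).ncard : ℝ)
      ≤ ((∑ g ∈ Finset.Icc 1 B, (2 * (B / g) + 1) ^ n *
        (g ^ (n - 1) * (2 * (A * (B / g)))) : ℕ) : ℝ) := by exact_mod_cast hcard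
    _ ≤ _ := sum_box_le hn A B
    _ ≤ _ := mul_le_mul_of_nonneg_left (floor_rpow_pow_le hn T) (by positivity)

end CharTorus

/-! ### Slice loci and induction on the rank. -/

namespace CharTorus

variable {K : Type*} [Field K] {L : Type*} [AddCommGroup L]

lemma finite_torsionZeros [Module.Free ℤ L] [Module.Finite ℤ L] (X : Set (AddChar L Kˣ)) (T : ℕ) :
    (torsionZeros X T).Finite := by
  have hfin : (⋃ N ∈ Finset.Icc 1 T, {x : AddChar L Kˣ | x ^ N = 1}).Finite := by
    refine (Finset.finite_toSet _).biUnion fun N hN => ?_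
    have : NeZero N := ⟨by have := (Finset.mem_Icc.1 hN).1; omega⟩
    exact finite_torsion (K := K) (Module.finBasis ℤ L) N
  refine hfin.subset ?_
  rintro ζ ⟨-, h1, h2⟩
  simp only [Set.mem_iUnion]
  exact ⟨orderOf ζ, Finset.mem_Icc.2 ⟨h1.orderOf_pos, h2⟩, pow_orderOf_eq_one ζ⟩

/-- The sum of the inverses of the orders of the points of `X` of order at most `T`. -/
noncomputable def torsionWeight (X : Set (AddChar L Kˣ)) (T : ℕ) : ℝ :=
  ∑ᶠ ζ ∈ torsionZeros X T, 1 / (orderOf ζ : ℝ)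

lemma torsionZeros_zero (X : Set (AddChar L Kˣ)) : torsionZeros X 0 = ∅ := by
  ext ζ
  simp only [torsionZeros, Set.mem_ofPred_eq, Set.mem_empty_iff_false, iff_false, not_and]
  intro _ h
  have := h.orderOf_pos
  omega

/-- Dyadic summation. -/
theorem exists_torsionWeight_le [Module.Free ℤ L] [Module.Finite ℤ L] (X : Set (AddChar L Kˣ))
    {β c : ℝ} (hβ : 0 < β) (h : ∀ T, ((torsionZeros X T).ncard : ℝ) ≤ c * (T : ℝ) ^ (β + 1)) :
    ∃ c' : ℝ, ∀ T, torsionWeight X T ≤ c' * (T : ℝ) ^ β := by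
  classical
  have hlt : (2 : ℝ) ^ (-β) < 1 := Real.rpow_lt_one_of_one_lt_of_neg (by norm_num) (by linarith)
  have hc : 0 ≤ c := by
    have := h 1
    simp only [Nat.cast_one, Real.one_rpow, mul_one] at this
    exact le_trans (by positivity) this
  -- The constant solves `c' * 2 ^ (-β) + 2 * c = c'`, which closes the induction from `T / 2` to
  -- `T`.
  refine ⟨2 * c / (1 - 2 ^ (-β)), fun T => ?_⟩
  have hc' : 0 ≤ 2 * c / (1 - 2 ^ (-β)) := div_nonneg (by linarith) (by linarith)
  have hceq : 2 * c / (1 - (2 : ℝ) ^ (-β)) * 2 ^ (-β) + 2 * c = 2 * c / (1 - 2 ^ (-β)) := by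
    have : 1 - (2 : ℝ) ^ (-β) ≠ 0 := by linarith
    field_simp
    ring
  set c' := 2 * c / (1 - (2 : ℝ) ^ (-β))
  induction T using Nat.strong_induction_on with
  | _ T ih =>
    rcases Nat.eq_zero_or_pos T with rfl | hT
    · simp only [torsionWeight, torsionZeros_zero]
      simp [Real.zero_rpow hβ.ne']
    have hT0 : (0 : ℝ) < T := by exact_mod_cast hT
    have hih := ih (T / 2) (by omega)
    unfold torsionWeight at hih ⊢
    rw [finsum_mem_eq_finite_toFinset_sum _ (finite_torsionZeros X _)] at hih ⊢
    set F := (finite_torsionZeros X T).toFinset with hF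
    set F' := (finite_torsionZeros X (T / 2)).toFinset with hF'
    have hsub : F' ⊆ F := by
      intro ζ
      simp only [hF, hF', Set.Finite.mem_toFinset]
      rintro ⟨h1, h2, h3⟩
      exact ⟨h1, h2, by omega⟩
    rw [← Finset.sum_sdiff hsub]
    -- A point outside `F'` has order above the integer quotient `T / 2`, so its weight is at most
    -- `2 / T`.
    have h1 : ∑ ζ ∈ F \ F', 1 / (orderOf ζ : ℝ) ≤ F.card * (2 / (T : ℝ)) := by
      refine (Finset.sum_le_card_nsmul _ _ (2 / (T : ℝ)) fun ζ hζ => ?_).trans ?_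
      · simp only [hF, hF', Finset.mem_sdiff, Set.Finite.mem_toFinset] at hζ
        have hnot : ¬ orderOf ζ ≤ T / 2 := fun hle => hζ.2 ⟨hζ.1.1, hζ.1.2.1, hle⟩
        have h2 : (T : ℝ) ≤ 2 * orderOf ζ := by exact_mod_cast (by omega : T ≤ 2 * orderOf ζ)
        rw [div_le_div_iff₀ (by linarith) hT0]
        linarith
      · rw [nsmul_eq_mul]
        refine mul_le_mul_of_nonneg_right ?_ (by positivity)
        exact_mod_cast Finset.card_le_card Finset.sdiff_subset
    have h2 : (F.card : ℝ) * (2 / (T : ℝ)) ≤ 2 * c * (T : ℝ) ^ β := by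
      have := h T
      rw [Set.ncard_eq_toFinset_card _ (finite_torsionZeros X T)] at this
      refine (mul_le_mul_of_nonneg_right this (by positivity)).trans (le_of_eq ?_)
      rw [Real.rpow_add_one hT0.ne']
      field_simp
    have h3 : c' * ((T / 2 : ℕ) : ℝ) ^ β ≤ c' * (2 : ℝ) ^ (-β) * (T : ℝ) ^ β := by
      rw [mul_assoc]
      refine mul_le_mul_of_nonneg_left ?_ hc'
      rw [Real.rpow_neg (by norm_num), ← Real.inv_rpow (by norm_num),
        ← Real.mul_rpow (by norm_num) hT0.le]
      refine Real.rpow_le_rpow (by positivity) ?_ hβ.le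
      have : ((T / 2 : ℕ) : ℝ) ≤ (T : ℝ) / (2 : ℕ) := Nat.cast_div_le
      push_cast at this
      linarith
    calc _ ≤ 2 * c * (T : ℝ) ^ β + c' * (2 : ℝ) ^ (-β) * (T : ℝ) ^ β := by linarith
      _ = (c' * 2 ^ (-β) + 2 * c) * (T : ℝ) ^ β := by ring
      _ = c' * (T : ℝ) ^ β := by rw [hceq]

/-- No coset `{x | x(a) = ζ(a)}`, with `a` a primitive vector and `ζ` a torsion point, is contained
in `X`. -/
def NoTorsionCoset (X : Set (AddChar L Kˣ)) : Prop :=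
  ∀ (a : L) (φ : L →ₗ[ℤ] ℤ), φ a = 1 → ∀ ζ : AddChar L Kˣ, IsOfFinOrder ζ → ∃ x, x a = ζ a ∧ x ∉ X

lemma mem_sliceLocus_iff (S : Finset (L →₀ K)) (b : L →ₗ[ℤ] ℤ) (x : AddChar L Kˣ) :
    x ∈ sliceLocus S b ↔ ∀ P ∈ S, ∀ a₀ ∈ P.support, slice b x P (b a₀) = 0 := by
  refine ⟨fun h P hP a₀ _ => h P hP _, fun h P hP m => ?_⟩
  by_cases hm : ∃ a₀ ∈ P.support, b a₀ = m
  · obtain ⟨a₀, ha₀, rfl⟩ := hm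
    exact h P hP a₀ ha₀
  · push Not at hm
    unfold slice
    rw [Finset.filter_false_of_mem hm, Finset.sum_empty]

/-- `sliceLocus S b` depends on `b` only through the set of pairs of exponents of `S` on which `b`
agrees, and there are finitely many such sets. -/
lemma finite_range_sliceLocus (S : Finset (L →₀ K)) : (Set.range (sliceLocus S)).Finite := by
  classical
  let A : Finset L := S.biUnion Finsupp.support
  let G : Finset (L × L) → Set (AddChar L Kˣ) := fun R =>
    {x | ∀ P ∈ S, ∀ a₀ ∈ P.support, ∑ a ∈ P.support with (a, a₀) ∈ R, P a * x a = 0}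
  refine (((A ×ˢ A).powerset.finite_toSet).image G).subset ?_
  rintro _ ⟨b, rfl⟩
  refine ⟨(A ×ˢ A).filter fun p => b p.1 = b p.2,
    Finset.mem_coe.2 (Finset.mem_powerset.2 (Finset.filter_subset _ _)), ?_⟩
  ext x
  rw [mem_sliceLocus_iff]
  refine forall₂_congr fun P hP => forall₂_congr fun a₀ ha₀ => ?_
  unfold slice
  have : ({a ∈ P.support | (a, a₀) ∈ (A ×ˢ A).filter fun p => b p.1 = b p.2}) =
      {a ∈ P.support | b a = b a₀} := by
    refine Finset.filter_congr fun a ha => ?_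
    have hA : ∀ a ∈ P.support, a ∈ A := fun a ha => Finset.mem_biUnion.2 ⟨P, hP, ha⟩
    simp only [Finset.mem_filter, Finset.mem_product, hA a ha, hA a₀ ha₀, true_and, and_self]
  rw [this]

/-- Dividing `b` by the generator `d` of its image relabels the slices without changing them. -/
lemma exists_primitive_sliceLocus (S : Finset (L →₀ K)) (b : L →ₗ[ℤ] ℤ) (hb : b ≠ 0) :
    ∃ (b' : L →ₗ[ℤ] ℤ) (f : L), b' f = 1 ∧ sliceLocus S b ⊆ sliceLocus S b' := by
  let d : ℤ := Submodule.IsPrincipal.generator (LinearMap.range b)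
  have hspan : LinearMap.range b = Submodule.span ℤ {d} :=
    (Submodule.IsPrincipal.span_singleton_generator _).symm
  have hdvd : ∀ a, d ∣ b a := fun a =>
    Ideal.mem_span_singleton.1 (show b a ∈ Submodule.span ℤ {d} from
      hspan ▸ LinearMap.mem_range_self b a)
  have hd : d ≠ 0 := by
    intro h
    apply hb
    ext a
    have := hdvd a
    rw [h, zero_dvd_iff] at this
    simp [this]
  obtain ⟨f, hf⟩ : d ∈ LinearMap.range b := Submodule.IsPrincipal.generator_mem _
  let b' : L →ₗ[ℤ] ℤ := AddMonoidHom.toIntLinearMap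
    { toFun := fun a => b a / d
      map_zero' := by simp
      map_add' := fun a a' => by rw [map_add, Int.add_ediv_of_dvd_left (hdvd a)] }
  have hb' : ∀ a, b a = d * b' a := fun a => (Int.mul_ediv_cancel' (hdvd a)).symm
  refine ⟨b', f, ?_, fun x hx P hP m => ?_⟩
  · have := hb' f
    rw [hf] at this
    exact mul_left_cancel₀ hd (by rw [← this, mul_one])
  · have := hx P hP (d * m)
    unfold slice at this ⊢
    rw [← this]
    refine Finset.sum_congr (Finset.filter_congr fun a _ => ?_) fun _ _ => rfl
    rw [hb', mul_right_inj' hd]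

lemma injective_coe_add (b : L →ₗ[ℤ] ℤ) (a₀ : L) :
    Function.Injective fun k : LinearMap.ker b => (k : L) + a₀ :=
  fun _ _ h => Subtype.ext (add_right_cancel h)

open Classical in
/-- Equations for the image of `sliceLocus S b` in the characters of the kernel of `b`. -/
noncomputable def kerSystem (S : Finset (L →₀ K)) (b : L →ₗ[ℤ] ℤ) :
    Finset (LinearMap.ker b →₀ K) :=
  S.biUnion fun P => P.support.image fun a₀ =>
    P.comapDomain (fun k : LinearMap.ker b => (k : L) + a₀)
      (injective_coe_add b a₀).injOn

/-- Restriction of characters to the kernel of `b`. -/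
def resKer (b : L →ₗ[ℤ] ℤ) (x : AddChar L Kˣ) : AddChar (LinearMap.ker b) Kˣ :=
  x.compAddMonoidHom (LinearMap.ker b).subtype.toAddMonoidHom

@[simp] lemma resKer_apply (b : L →ₗ[ℤ] ℤ) (x : AddChar L Kˣ) (k : LinearMap.ker b) :
    resKer b x k = x k := rfl

/-- Dividing the slice through `a₀` by the unit `x a₀` moves its exponents into `ker b`. -/
lemma resKer_mem_vanishing_iff (S : Finset (L →₀ K)) (b : L →ₗ[ℤ] ℤ) (x : AddChar L Kˣ) :
    resKer b x ∈ vanishing (kerSystem S b) ↔ x ∈ sliceLocus S b := by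
  classical
  rw [mem_sliceLocus_iff]
  have key : ∀ (P : L →₀ K) (a₀ : L), charEval (resKer b x)
      (P.comapDomain (fun k : LinearMap.ker b => (k : L) + a₀)
        (injective_coe_add b a₀).injOn) * x a₀ = slice b x P (b a₀) := by
    intro P a₀
    unfold charEval slice
    rw [Finset.sum_mul]
    refine Finset.sum_bij (fun k _ => (k : L) + a₀) ?_ ?_ ?_ ?_
    · intro k hk
      rw [Finsupp.mem_support_iff, Finsupp.comapDomain_apply] at hk
      simp [hk]
    · intro k _ k' _ h
      exact Subtype.ext (add_right_cancel h)
    · intro a ha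
      rw [Finset.mem_filter, Finsupp.mem_support_iff] at ha
      refine ⟨⟨a - a₀, by simp [ha.2]⟩, ?_, by simp⟩
      rw [Finsupp.mem_support_iff, Finsupp.comapDomain_apply]
      simpa using ha.1
    · intro k _
      rw [Finsupp.comapDomain_apply, AddChar.map_add_eq_mul, Units.val_mul, resKer_apply, mul_assoc]
  have hP : ∀ P a₀, charEval (resKer b x)
      (P.comapDomain (fun k : LinearMap.ker b => (k : L) + a₀)
        (injective_coe_add b a₀).injOn) = 0 ↔ slice b x P (b a₀) = 0 := by
    intro P a₀
    rw [← key, mul_eq_zero, or_iff_left (Units.ne_zero _)]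
  simp only [vanishing, kerSystem, Set.mem_ofPred_eq, Finset.mem_biUnion, Finset.mem_image]
  constructor
  · intro h P hPS a₀ ha₀
    exact (hP P a₀).1 (h _ ⟨P, hPS, a₀, ha₀, rfl⟩)
  · rintro h _ ⟨P, hPS, a₀, ha₀, rfl⟩
    exact (hP P a₀).2 (h P hPS a₀ ha₀)

/-- The projection to the kernel of `b` along a vector `f` with `b f = 1`. -/
def projKer (b : L →ₗ[ℤ] ℤ) (f : L) (hf : b f = 1) : L →ₗ[ℤ] LinearMap.ker b :=
  LinearMap.codRestrict _ (LinearMap.id - (LinearMap.toSpanSingleton ℤ L f).comp b) fun a => by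
    simp [hf]

lemma projKer_coe (b : L →ₗ[ℤ] ℤ) (f : L) (hf : b f = 1) (k : LinearMap.ker b) :
    projKer b f hf k = k := by
  apply Subtype.ext
  have : b k = 0 := k.2
  simp [projKer, this]

lemma isOfFinOrder_comp {M : Type*} [AddCommGroup M] (ζ : AddChar M Kˣ) (hζ : IsOfFinOrder ζ)
    (p : L →+ M) : IsOfFinOrder (ζ.compAddMonoidHom p) := by
  rw [isOfFinOrder_iff_pow_eq_one] at hζ ⊢
  obtain ⟨N, hN, h⟩ := hζ
  refine ⟨N, hN, ?_⟩
  ext a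
  rw [AddChar.pow_apply, AddChar.compAddMonoidHom_apply, ← AddChar.pow_apply, h]
  rfl

/-- The preimage of a codimension-one torsion coset under restriction to `ker b` is again one, and
the preimage of the new zero set is `sliceLocus S b`, inside the old zero set. -/
lemma NoTorsionCoset.kerSystem {S : Finset (L →₀ K)} (h : NoTorsionCoset (vanishing S))
    (b : L →ₗ[ℤ] ℤ) (f : L) (hf : b f = 1) : NoTorsionCoset (vanishing (kerSystem S b)) := by
  intro a φ hφ ζ hζ
  obtain ⟨x, hx, hxS⟩ := h a (φ.comp (projKer b f hf)) (by simp [projKer_coe, hφ])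
    (ζ.compAddMonoidHom (projKer b f hf).toAddMonoidHom) (isOfFinOrder_comp ζ hζ _)
  refine ⟨resKer b x, ?_, fun hmem => hxS ?_⟩
  · rw [resKer_apply, hx]
    simp [projKer_coe]
  · exact sliceLocus_subset_vanishing S b ((resKer_mem_vanishing_iff S b x).1 hmem)

lemma eq_of_resKer_eq (b : L →ₗ[ℤ] ℤ) (f : L) (hf : b f = 1) {x y : AddChar L Kˣ}
    (h : resKer b x = resKer b y) (h' : x f = y f) : x = y := by
  apply AddChar.ext
  intro a
  have ha : a = (projKer b f hf a : L) + b a • f := by simp [projKer]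
  rw [ha, AddChar.map_add_eq_mul, AddChar.map_add_eq_mul, AddChar.map_zsmul_eq_zpow,
    AddChar.map_zsmul_eq_zpow, h', ← resKer_apply, h, resKer_apply]

/-- Torsion points of `sliceLocus S b` are controlled by those of its image in the characters of
the kernel of `b`. -/
theorem ncard_sliceLocus_le [Module.Free ℤ L] [Module.Finite ℤ L] (S : Finset (L →₀ K))
    (b : L →ₗ[ℤ] ℤ) (f : L) (hf : b f = 1) (T : ℕ) :
    ((torsionZeros (sliceLocus S b) T).ncard : ℝ) ≤
      (T : ℝ) ^ 2 * torsionWeight (vanishing (kerSystem S b)) T := by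
  classical
  unfold torsionWeight
  have hYfin := finite_torsionZeros (vanishing (kerSystem S b)) T
  rw [finsum_mem_eq_finite_toFinset_sum _ hYfin]
  set Y := hYfin.toFinset with hY
  -- Above `y` of order `M`, a point of order at most `T` has order `M * j` with `j ≤ T / M`, and is
  -- determined by its value at `f`, an `M * j`-th root of unity.
  let U : AddChar (LinearMap.ker b) Kˣ → Finset K := fun y =>
    (Finset.Icc 1 (T / orderOf y)).biUnion fun j => (Polynomial.nthRoots (orderOf y * j) 1).toFinset
  have hU : ∀ y, (U y).card ≤ T / orderOf y * T := by
    intro y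
    refine Finset.card_biUnion_le.trans ?_
    refine (Finset.sum_le_card_nsmul _ _ T fun j hj => ?_).trans ?_
    · refine (Multiset.toFinset_card_le _).trans ((Polynomial.card_nthRoots _ _).trans ?_)
      exact (Nat.mul_le_mul_left _ (Finset.mem_Icc.1 hj).2).trans (Nat.mul_div_le _ _)
    · simp
  let Φ : AddChar L Kˣ → Σ _ : AddChar (LinearMap.ker b) Kˣ, K := fun ζ => ⟨resKer b ζ, (ζ f : K)⟩
  have hmaps : ∀ ζ ∈ torsionZeros (sliceLocus S b) T, Φ ζ ∈ Y.sigma U := by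
    rintro ζ ⟨h1, h2, h3⟩
    have hres : resKer b ζ ^ orderOf ζ = 1 := by
      apply AddChar.ext
      intro k
      rw [AddChar.pow_apply, resKer_apply, ← AddChar.pow_apply, pow_orderOf_eq_one]
      rfl
    obtain ⟨j, hj⟩ := orderOf_dvd_of_pow_eq_one hres
    have hpos := h2.orderOf_pos
    have hjpos : 0 < j := Nat.pos_of_ne_zero fun h => by rw [h, mul_zero] at hj; omega
    have hopos : 0 < orderOf (resKer b ζ) :=
      Nat.pos_of_ne_zero fun h => by rw [h, zero_mul] at hj; omega
    have hle : orderOf (resKer b ζ) ≤ T :=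
      (Nat.le_mul_of_pos_right _ hjpos).trans (hj ▸ h3)
    simp only [Finset.mem_sigma, hY, Set.Finite.mem_toFinset, Φ, U, Finset.mem_biUnion,
      Multiset.mem_toFinset]
    refine ⟨⟨(resKer_mem_vanishing_iff S b ζ).2 h1, orderOf_pos_iff.1 hopos, hle⟩, j, ?_, ?_⟩
    · rw [Finset.mem_Icc, Nat.le_div_iff_mul_le hopos, mul_comm, ← hj]
      exact ⟨hjpos, h3⟩
    · rw [Polynomial.mem_nthRoots (hj ▸ hpos), ← hj, ← Units.val_pow_eq_pow_val, ← AddChar.pow_apply,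
        pow_orderOf_eq_one]
      rfl
  have hinj : Set.InjOn Φ (torsionZeros (sliceLocus S b) T) := by
    intro ζ _ ζ' _ h
    simp only [Φ, Sigma.mk.injEq, heq_eq_eq] at h
    exact eq_of_resKer_eq b f hf h.1 (Units.ext h.2)
  have hcard : (torsionZeros (sliceLocus S b) T).ncard ≤ (Y.sigma U).card := by
    rw [← Set.ncard_coe_finset]
    exact Set.ncard_le_ncard_of_injOn Φ (fun ζ hζ => hmaps ζ hζ) hinj (Finset.finite_toSet _)
  calc ((torsionZeros (sliceLocus S b) T).ncard : ℝ) ≤ ((Y.sigma U).card : ℝ) := by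
        exact_mod_cast hcard
    _ = ∑ y ∈ Y, ((U y).card : ℝ) := by rw [Finset.card_sigma]; push_cast; rfl
    _ ≤ ∑ y ∈ Y, (T : ℝ) ^ 2 * (1 / (orderOf y : ℝ)) := by
        refine Finset.sum_le_sum fun y _ => ?_
        have h1 : ((U y).card : ℝ) ≤ ((T / orderOf y : ℕ) : ℝ) * T := by exact_mod_cast hU y
        have h2 : ((T / orderOf y : ℕ) : ℝ) ≤ (T : ℝ) / orderOf y := Nat.cast_div_le
        refine h1.trans ((mul_le_mul_of_nonneg_right h2 (by positivity)).trans (le_of_eq ?_))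
        ring
    _ = _ := by rw [← Finset.mul_sum]

lemma torsionZeros_subset_union (S : Finset (L →₀ K)) (T : ℕ) :
    torsionZeros (vanishing S) T ⊆
      torsionZeros (vanishing S \ ⋃ b ≠ 0, sliceLocus S b) T ∪
        ⋃ X ∈ sliceLocus S '' {b | ∃ f, b f = 1}, torsionZeros X T := by
  rintro ζ ⟨h1, h2⟩
  by_cases h : ζ ∈ ⋃ b ≠ 0, sliceLocus S b
  · right
    simp only [Set.mem_iUnion] at h
    obtain ⟨b, hb, hζ⟩ := h
    obtain ⟨b', f, hf, hsub⟩ := exists_primitive_sliceLocus S b hb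
    simp only [Set.mem_iUnion]
    exact ⟨_, ⟨b', ⟨f, hf⟩, rfl⟩, hsub hζ, h2⟩
  · exact Or.inl ⟨⟨h1, h⟩, h2⟩

/-- For `T > 0` the exponents on the left add up to `n - 1 / (n - 1)`. -/
lemma rpow_sq_mul_le {n : ℕ} (hn : 2 ≤ n) (T : ℕ) :
    (T : ℝ) ^ 2 * (T : ℝ) ^ (((n - 1 : ℕ) : ℝ) - 1 - 1 / ((n - 1 : ℕ) : ℝ)) ≤
      (T : ℝ) ^ ((n : ℝ) - 1 / n) := by
  rcases Nat.eq_zero_or_pos T with rfl | hT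
  · simp only [Nat.cast_zero]
    rw [zero_pow two_ne_zero, zero_mul]
    positivity
  · have hT0 : (0 : ℝ) < T := by exact_mod_cast hT
    have hn1 : (0 : ℝ) < ((n - 1 : ℕ) : ℝ) := by exact_mod_cast (by omega : 0 < n - 1)
    rw [← Real.rpow_natCast, ← Real.rpow_add hT0]
    refine Real.rpow_le_rpow_of_exponent_le (by exact_mod_cast hT) ?_
    have h1 : 1 / (n : ℝ) ≤ 1 / ((n - 1 : ℕ) : ℝ) :=
      one_div_le_one_div_of_le hn1 (by exact_mod_cast Nat.sub_le n 1)
    have h2 : ((n - 1 : ℕ) : ℝ) = n - 1 := by rw [Nat.cast_sub (by omega)]; simp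
    rw [h2] at h1 ⊢
    push_cast
    linarith

/-- Passage from weights in rank `n - 1` to counts in rank `n`; it serves both the inductive step
and the final count. -/
theorem exists_ncard_le_of_kerSystem [Module.Free ℤ L] [Module.Finite ℤ L] {n : ℕ} (hn : 2 ≤ n)
    (hL : Module.finrank ℤ L = n) (S : Finset (L →₀ K))
    (h : ∀ (b : L →ₗ[ℤ] ℤ) (f : L), b f = 1 → ∃ c : ℝ, ∀ T : ℕ,
      torsionWeight (vanishing (kerSystem S b)) T ≤
        c * (T : ℝ) ^ (((n - 1 : ℕ) : ℝ) - 1 - 1 / ((n - 1 : ℕ) : ℝ))) :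
    ∃ c : ℝ, ∀ T : ℕ, ((torsionZeros (vanishing S) T).ncard : ℝ) ≤
      c * (T : ℝ) ^ ((n : ℝ) - 1 / n) := by
  classical
  obtain ⟨c₀, hc₀⟩ := exists_ncard_off_slices_le (by omega)
    (Module.finBasisOfFinrankEq ℤ L hL) S
  have hfin : (sliceLocus S '' {b | ∃ f, b f = 1}).Finite :=
    (finite_range_sliceLocus S).subset (Set.image_subset_range _ _)
  have hX : ∀ X ∈ sliceLocus S '' {b | ∃ f, b f = 1}, ∃ c : ℝ, ∀ T : ℕ,
      ((torsionZeros X T).ncard : ℝ) ≤ c * (T : ℝ) ^ ((n : ℝ) - 1 / n) := by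
    rintro _ ⟨b, ⟨f, hf⟩, rfl⟩
    obtain ⟨c, hc⟩ := h b f hf
    refine ⟨|c|, fun T => (ncard_sliceLocus_le S b f hf T).trans ?_⟩
    have h1 : (T : ℝ) ^ 2 * torsionWeight (vanishing (kerSystem S b)) T ≤ (T : ℝ) ^ 2 *
        (|c| * (T : ℝ) ^ (((n - 1 : ℕ) : ℝ) - 1 - 1 / ((n - 1 : ℕ) : ℝ))) := by
      refine mul_le_mul_of_nonneg_left ((hc T).trans ?_) (by positivity)
      exact mul_le_mul_of_nonneg_right (le_abs_self c) (by positivity)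
    refine h1.trans ?_
    rw [mul_left_comm]
    exact mul_le_mul_of_nonneg_left (rpow_sq_mul_le hn T) (abs_nonneg c)
  choose! C hC using hX
  refine ⟨c₀ + ∑ X ∈ hfin.toFinset, C X, fun T => ?_⟩
  have hsub := torsionZeros_subset_union S T
  have hrew : (⋃ X ∈ sliceLocus S '' {b | ∃ f, b f = 1}, torsionZeros X T) =
      ⋃ X ∈ hfin.toFinset, torsionZeros X T := by simp
  rw [hrew] at hsub
  have hcard : (torsionZeros (vanishing S) T).ncard ≤
      (torsionZeros (vanishing S \ ⋃ b ≠ 0, sliceLocus S b) T).ncard +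
        ∑ X ∈ hfin.toFinset, (torsionZeros X T).ncard := by
    refine (Set.ncard_le_ncard hsub ((finite_torsionZeros _ T).union
      ((Finset.finite_toSet _).biUnion fun X _ => finite_torsionZeros X T))).trans ?_
    exact (Set.ncard_union_le _ _).trans (Nat.add_le_add_left (Finset.set_ncard_biUnion_le _ _) _)
  calc ((torsionZeros (vanishing S) T).ncard : ℝ)
      ≤ ((torsionZeros (vanishing S \ ⋃ b ≠ 0, sliceLocus S b) T).ncard : ℝ) +
        ∑ X ∈ hfin.toFinset, ((torsionZeros X T).ncard : ℝ) := by exact_mod_cast hcard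
    _ ≤ c₀ * (T : ℝ) ^ ((n : ℝ) - 1 / n) +
        ∑ X ∈ hfin.toFinset, C X * (T : ℝ) ^ ((n : ℝ) - 1 / n) :=
        add_le_add (hc₀ T) (Finset.sum_le_sum fun X hX => hC X (hfin.mem_toFinset.1 hX) T)
    _ = _ := by rw [← Finset.sum_mul, ← add_mul]

lemma finrank_ker_add_one [Module.Free ℤ L] [Module.Finite ℤ L] (b : L →ₗ[ℤ] ℤ) (f : L)
    (hf : b f = 1) : Module.finrank ℤ (LinearMap.ker b) + 1 = Module.finrank ℤ L := by
  have hsurj : Function.Surjective b := fun m => ⟨m • f, by simp [hf]⟩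
  rw [← Submodule.finrank_quotient_add_finrank (LinearMap.ker b),
    (b.quotKerEquivOfSurjective hsurj).finrank_eq, Module.finrank_self, add_comm]

/-- A set without torsion cosets of codimension one in a one-dimensional torus has no torsion
points. -/
lemma torsionZeros_eq_empty [Module.Free ℤ L] [Module.Finite ℤ L] (hL : Module.finrank ℤ L = 1)
    {X : Set (AddChar L Kˣ)} (h : NoTorsionCoset X) (T : ℕ) : torsionZeros X T = ∅ := by
  rw [Set.eq_empty_iff_forall_notMem]
  rintro ζ ⟨h1, h2, -⟩
  let e := Module.finBasisOfFinrankEq ℤ L hL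
  obtain ⟨x, hx, hxX⟩ := h (e 0) (e.coord 0) (by simp) ζ h2
  refine hxX ?_
  have : x = ζ := ext_basis e fun i => by rw [Subsingleton.elim i 0, hx]
  rwa [this]

-- The induction runs on weights, over all lattices of the given rank since `ker b` carries no
-- preferred basis. In rank one there are no torsion zeros, so the negative exponent is harmless;
-- from rank two on the exponent is positive, as dyadic summation requires.
universe u in
theorem exists_torsionWeight_vanishing_le {K : Type*} [Field K] (n : ℕ) (hn : 1 ≤ n) :
    ∀ (L : Type u) [AddCommGroup L] [Module.Free ℤ L] [Module.Finite ℤ L],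
      Module.finrank ℤ L = n → ∀ S : Finset (L →₀ K), NoTorsionCoset (vanishing S) →
        ∃ c : ℝ, ∀ T : ℕ, torsionWeight (vanishing S) T ≤ c * (T : ℝ) ^ ((n : ℝ) - 1 - 1 / n) := by
  induction n, hn using Nat.le_induction with
  | base =>
    intro L _ _ _ hL S hS
    refine ⟨0, fun T => ?_⟩
    simp [torsionWeight, torsionZeros_eq_empty hL hS]
  | succ n hn ih =>
    intro L _ _ _ hL S hS
    obtain ⟨c, hc⟩ := exists_ncard_le_of_kerSystem (n := n + 1) (by omega) hL S fun b f hf =>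
      ih (LinearMap.ker b) (by have := finrank_ker_add_one b f hf; omega) (kerSystem S b)
        (hS.kerSystem b f hf)
    refine exists_torsionWeight_le (vanishing S) (β := ((n + 1 : ℕ) : ℝ) - 1 - 1 / (n + 1 : ℕ))
      (c := c) ?_ fun T => ?_
    · have h1 : (1 : ℝ) ≤ n := by exact_mod_cast hn
      have h2 : 1 / ((n + 1 : ℕ) : ℝ) < 1 := by
        rw [div_lt_one (by positivity)]
        push_cast
        linarith
      push_cast at h2 ⊢
      linarith
    · have := hc T
      rwa [show ((n + 1 : ℕ) : ℝ) - 1 - 1 / (n + 1 : ℕ) + 1 = ((n + 1 : ℕ) : ℝ) - 1 / (n + 1 : ℕ) by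
        ring]

/-- The zero set of finitely many equations that contains no torsion coset of codimension one has
at most `O(T ^ (n - 1 / n))` torsion points of order at most `T`. -/
theorem exists_ncard_torsionZeros_le [Module.Free ℤ L] [Module.Finite ℤ L] {n : ℕ} (hn : 2 ≤ n)
    (hL : Module.finrank ℤ L = n) (S : Finset (L →₀ K)) (hS : NoTorsionCoset (vanishing S)) :
    ∃ c : ℝ, ∀ T : ℕ, ((torsionZeros (vanishing S) T).ncard : ℝ) ≤
      c * (T : ℝ) ^ ((n : ℝ) - 1 / n) :=
  exists_ncard_le_of_kerSystem hn hL S fun b f hf =>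
    exists_torsionWeight_vanishing_le (n - 1) (by omega) (LinearMap.ker b)
      (by have := finrank_ker_add_one b f hf; omega) (kerSystem S b) (hS.kerSystem b f hf)

end CharTorus

/-! ### Dictionary between points of the torus and characters of `ℤ^n`. -/

namespace Torus

variable {K : Type*} [Field K] {n : ℕ}

/-- Points of `𝔾_m^n` are the characters of `ℤ^n`. -/
def toChar : Torus K n ≃* AddChar (Fin n → ℤ) Kˣ where
  toFun x :=
    { toFun := fun a => ∏ i, x i ^ a i
      map_zero_eq_one' := by simp
      map_add_eq_mul' := fun a b => by simp [zpow_add, Finset.prod_mul_distrib] }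
  invFun χ i := χ (Pi.single i 1)
  left_inv x := by
    funext i
    simp only [AddChar.coe_mk]
    rw [Finset.prod_eq_single i]
    · simp
    · intro j _ hj
      simp [Pi.single_eq_of_ne hj]
    · simp
  right_inv χ := by
    refine CharTorus.ext_basis (Pi.basisFun ℤ (Fin n)) fun i => ?_
    simp only [AddChar.coe_mk, Pi.basisFun_apply]
    rw [Finset.prod_eq_single i]
    · simp
    · intro j _ hj
      simp [Pi.single_eq_of_ne hj]
    · simp
  map_mul' x y := by
    ext a
    simp [mul_zpow, Finset.prod_mul_distrib]

lemma toChar_apply (x : Torus K n) (a : Fin n → ℤ) : toChar x a = ∏ i, x i ^ a i := rfl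

lemma toChar_symm_apply (χ : AddChar (Fin n → ℤ) Kˣ) (i : Fin n) :
    toChar.symm χ i = χ (Pi.single i 1) := rfl

lemma eval_eq_charEval (x : Torus K n) (P : LaurentRing K n) :
    eval x P = CharTorus.charEval (toChar x) P.coeff := by
  rw [eval, AddMonoidAlgebra.lift_apply]
  rfl

@[simp] lemma eval_single (x : Torus K n) (a : Fin n → ℤ) (c : K) :
    eval x (AddMonoidAlgebra.single a c) = c * toChar x a := by
  rw [eval, AddMonoidAlgebra.lift_single, smul_eq_mul]
  rfl

lemma exists_unit_pow_ne_one [Infinite K] (k : ℤ) (hk : k ≠ 0) : ∃ u : Kˣ, u ^ k ≠ 1 := by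
  by_contra! h
  have hpos : 0 < k.natAbs := Int.natAbs_pos.2 hk
  have h2 : ∀ u : Kˣ, u ^ k.natAbs = 1 := fun u => by
    have := h u
    rcases Int.natAbs_eq k with h' | h'
    · rw [h', zpow_natCast] at this
      exact this
    · rw [h', zpow_neg, inv_eq_one, zpow_natCast] at this
      exact this
  have : NeZero k.natAbs := ⟨hpos.ne'⟩
  have hfin : Finite Kˣ := Finite.of_injective
    (fun u : Kˣ => (⟨u, (mem_rootsOfUnity _ _).2 (h2 u)⟩ : rootsOfUnity k.natAbs K))
    fun u v h => congrArg Subtype.val h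
  refine Set.infinite_univ (α := K) (((Set.finite_range (Units.val : Kˣ → K)).insert 0).subset ?_)
  intro x _
  rcases eq_or_ne x 0 with rfl | hx
  · exact Set.mem_insert _ _
  · exact Set.mem_insert_of_mem _ ⟨Units.mk0 x hx, rfl⟩

/-- The value of a monomial, as a homomorphism in the point. -/
noncomputable def monomialChar (a : Fin n → ℤ) : Torus K n →* K where
  toFun x := (toChar x a : K)
  map_one' := by simp
  map_mul' x y := by simp

lemma monomialChar_injective [Infinite K] :
    Function.Injective (monomialChar : (Fin n → ℤ) → (Torus K n →* K)) := by
  intro a b h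
  funext i
  by_contra hne
  obtain ⟨u, hu⟩ := exists_unit_pow_ne_one (K := K) (a i - b i) (sub_ne_zero.2 hne)
  apply hu
  have h1 : ∀ c : Fin n → ℤ, toChar (Pi.mulSingle i u : Torus K n) c = u ^ c i := by
    intro c
    rw [toChar_apply, Finset.prod_eq_single i]
    · simp
    · intro j _ hj
      simp [Pi.mulSingle_eq_of_ne hj]
    · simp
  have h2 : toChar (Pi.mulSingle i u : Torus K n) a = toChar (Pi.mulSingle i u) b :=
    Units.ext (DFunLike.congr_fun h (Pi.mulSingle i u : Torus K n))
  rw [h1, h1] at h2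
  rw [zpow_sub, h2, mul_inv_cancel]

/-- Distinct monomials are distinct characters of the torus over an infinite field, hence linearly
independent by Dedekind. -/
lemma eq_zero_of_forall_eval [Infinite K] (P : LaurentRing K n) (h : ∀ x, eval x P = 0) :
    P = 0 := by
  have hli : LinearIndependent K fun a : Fin n → ℤ => (monomialChar a : Torus K n → K) :=
    (linearIndependent_monoidHom (Torus K n) K).comp _ monomialChar_injective
  rw [linearIndependent_iff] at hli
  have : P.coeff = 0 := by
    apply hli
    funext x
    rw [Finsupp.linearCombination_apply, Finsupp.sum, Finset.sum_apply]
    have := h x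
    rw [eval_eq_charEval] at this
    exact this
  exact AddMonoidAlgebra.ext (by rw [this]; rfl)

/-- The substitution `X^a ↦ ζ^a X^{p(a)}`. -/
noncomputable def substHom (ζ : Torus K n) (p : (Fin n → ℤ) →ₗ[ℤ] (Fin n → ℤ)) :
    LaurentRing K n →ₐ[K] LaurentRing K n :=
  AddMonoidAlgebra.lift K (LaurentRing K n) (Fin n → ℤ)
    { toFun := fun a => AddMonoidAlgebra.single (p a.toAdd) ((toChar ζ a.toAdd : Kˣ) : K)
      map_one' := by simp [AddMonoidAlgebra.one_def]
      map_mul' := fun a b => by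
        simp [AddMonoidAlgebra.single_mul_single, AddChar.map_add_eq_mul] }

/-- The map of `𝔾_m^n` dual to `substHom`. -/
noncomputable def substMap (ζ : Torus K n) (p : (Fin n → ℤ) →ₗ[ℤ] (Fin n → ℤ)) (y : Torus K n) :
    Torus K n := ζ * toChar.symm ((toChar y).compAddMonoidHom p.toAddMonoidHom)

lemma toChar_substMap (ζ : Torus K n) (p : (Fin n → ℤ) →ₗ[ℤ] (Fin n → ℤ)) (y : Torus K n)
    (a : Fin n → ℤ) : toChar (substMap ζ p y) a = toChar ζ a * toChar y (p a) := by
  rw [substMap, map_mul, MulEquiv.apply_symm_apply]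
  rfl

lemma eval_substHom (ζ : Torus K n) (p : (Fin n → ℤ) →ₗ[ℤ] (Fin n → ℤ)) (y : Torus K n)
    (P : LaurentRing K n) : eval y (substHom ζ p P) = eval (substMap ζ p y) P := by
  induction P using AddMonoidAlgebra.induction_linear with
  | zero => simp
  | add f g hf hg => simp [hf, hg]
  | single a c =>
    rw [substHom, AddMonoidAlgebra.lift_single, map_smul, eval_single, toChar_substMap]
    simp

/-! ### Zariski topology, flags of cosets and their dimension. -/

section Zariski

attribute [local instance] zariski

lemma isClosed_iff (Z : Set (Torus K n)) :
    IsClosed Z ↔ ∃ S : Set (LaurentRing K n), Z = commonZeros S := by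
  rw [← isOpen_compl_iff]
  change Zᶜᶜ ∈ {X | ∃ S : Set (LaurentRing K n), X = commonZeros S} ↔ _
  rw [compl_compl]
  rfl

lemma isClosed_zeroLocus (P : LaurentRing K n) : IsClosed (zeroLocus P) :=
  (isClosed_iff _).2 ⟨{P}, by ext; simp [zeroLocus, commonZeros]⟩

lemma continuous_substMap (ζ : Torus K n) (p : (Fin n → ℤ) →ₗ[ℤ] (Fin n → ℤ)) :
    Continuous (substMap ζ p) := by
  rw [continuous_iff_isClosed]
  intro Z hZ
  obtain ⟨S, rfl⟩ := (isClosed_iff Z).1 hZ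
  refine (isClosed_iff _).2 ⟨substHom ζ p '' S, ?_⟩
  ext y
  simp [commonZeros, eval_substHom]

/-- The Laurent polynomial ring is a domain, and its elements are determined by their values. -/
lemma isIrreducible_univ [Infinite K] : IsIrreducible (Set.univ : Set (Torus K n)) := by
  refine ⟨Set.univ_nonempty, ?_⟩
  rw [isPreirreducible_iff_isClosed_union_isClosed]
  intro Z₁ Z₂ h₁ h₂ h
  obtain ⟨S₁, rfl⟩ := (isClosed_iff Z₁).1 h₁
  obtain ⟨S₂, rfl⟩ := (isClosed_iff Z₂).1 h₂
  by_contra! hc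
  simp only [Set.not_subset, commonZeros, Set.mem_ofPred_eq, not_forall] at hc
  obtain ⟨⟨x, -, P, hP, hPx⟩, y, -, Q, hQ, hQy⟩ := hc
  have hPQ : P * Q = 0 := by
    refine eq_zero_of_forall_eval _ fun z => ?_
    rw [map_mul]
    rcases h (Set.mem_univ z) with hz | hz
    · rw [hz P hP, zero_mul]
    · rw [hz Q hQ, mul_zero]
  rcases mul_eq_zero.1 hPQ with h0 | h0
  · simp [h0] at hPx
  · simp [h0] at hQy

/-- The translate by `ζ` of the subgroup `{x | x^{e_i} = 1 for i < j}`, for a basis `e` of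
`ℤ^n`. -/
def flagCoset (e : Module.Basis (Fin n) ℤ (Fin n → ℤ)) (ζ : Torus K n) (j : ℕ) :
    Set (Torus K n) := {x | ∀ i : Fin n, (i : ℕ) < j → toChar x (e i) = toChar ζ (e i)}

/-- The projection killing the first `j` basis vectors. -/
noncomputable def flagProj (e : Module.Basis (Fin n) ℤ (Fin n → ℤ)) (j : ℕ) :
    (Fin n → ℤ) →ₗ[ℤ] (Fin n → ℤ) := e.constr ℤ fun i => if (i : ℕ) < j then 0 else e i

lemma substMap_flagProj_mem (e : Module.Basis (Fin n) ℤ (Fin n → ℤ)) (ζ : Torus K n) (j : ℕ)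
    (y : Torus K n) : substMap ζ (flagProj e j) y ∈ flagCoset e ζ j := by
  intro i hi
  rw [toChar_substMap, flagProj, e.constr_basis, if_pos hi, AddChar.map_zero_eq_one, mul_one]

lemma exists_substMap_flagProj_eq (e : Module.Basis (Fin n) ℤ (Fin n → ℤ)) (ζ : Torus K n) (j : ℕ)
    {x : Torus K n} (hx : x ∈ flagCoset e ζ j) : ∃ y, substMap ζ (flagProj e j) y = x := by
  refine ⟨x * ζ⁻¹, toChar.injective (CharTorus.ext_basis e fun i => ?_)⟩
  rw [toChar_substMap, flagProj, e.constr_basis]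
  split_ifs with hi
  · rw [AddChar.map_zero_eq_one, mul_one, hx i hi]
  · rw [map_mul, map_inv, AddChar.mul_apply, AddChar.inv_apply', mul_comm (toChar x (e i)),
      mul_inv_cancel_left]

lemma flagCoset_eq_commonZeros (e : Module.Basis (Fin n) ℤ (Fin n → ℤ)) (ζ : Torus K n) (j : ℕ) :
    flagCoset e ζ j = commonZeros ((fun i : Fin n => (AddMonoidAlgebra.single (e i) 1 -
      AddMonoidAlgebra.single 0 ((toChar ζ (e i) : Kˣ) : K) : LaurentRing K n)) ''
        {i | (i : ℕ) < j}) := by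
  ext x
  simp [flagCoset, commonZeros, sub_eq_zero, Units.ext_iff]

lemma isAlgebraicSet_flagCoset (e : Module.Basis (Fin n) ℤ (Fin n → ℤ)) (ζ : Torus K n) (j : ℕ) :
    IsAlgebraicSet (flagCoset e ζ j) :=
  ⟨(Set.toFinite _).toFinset, by rw [flagCoset_eq_commonZeros, Set.Finite.coe_toFinset]⟩

lemma isClosed_flagCoset (e : Module.Basis (Fin n) ℤ (Fin n → ℤ)) (ζ : Torus K n) (j : ℕ) :
    IsClosed (flagCoset e ζ j) := (isClosed_iff _).2 ⟨_, flagCoset_eq_commonZeros e ζ j⟩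

lemma isIrreducible_flagCoset [Infinite K] (e : Module.Basis (Fin n) ℤ (Fin n → ℤ)) (ζ : Torus K n)
    (j : ℕ) : IsIrreducible (flagCoset e ζ j) := by
  have h : flagCoset e ζ j = substMap ζ (flagProj e j) '' Set.univ := by
    ext x
    simp only [Set.image_univ, Set.mem_range]
    refine ⟨exists_substMap_flagProj_eq e ζ j, ?_⟩
    rintro ⟨y, rfl⟩
    exact substMap_flagProj_mem e ζ j y
  rw [h]
  exact isIrreducible_univ.image _ (continuous_substMap _ _).continuousOn

lemma flagCoset_anti (e : Module.Basis (Fin n) ℤ (Fin n → ℤ)) (ζ : Torus K n) {j k : ℕ}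
    (hjk : j ≤ k) : flagCoset e ζ k ⊆ flagCoset e ζ j :=
  fun _ hx i hi => hx i (hi.trans_le hjk)

lemma exists_mem_flagCoset_notMem [Infinite K] (e : Module.Basis (Fin n) ℤ (Fin n → ℤ))
    (ζ : Torus K n) {j k : ℕ} (hjk : j < k) (hjn : j < n) :
    ∃ x ∈ flagCoset e ζ j, x ∉ flagCoset e ζ k := by
  obtain ⟨u, hu⟩ := exists_unit_pow_ne_one (K := K) 1 one_ne_zero
  rw [zpow_one] at hu
  refine ⟨_, substMap_flagProj_mem e ζ j (toChar.symm (CharTorus.cochar (e.coord ⟨j, hjn⟩) u)),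
    fun h => hu ?_⟩
  have := h ⟨j, hjn⟩ hjk
  rw [toChar_substMap, flagProj, e.constr_basis, MulEquiv.apply_symm_apply] at this
  simpa using this

/-- The cosets `flagCoset e ζ (k + 1)`, for `k` from `0` to `m`, form a strictly decreasing chain of
irreducible closed sets, each an image of the whole torus under a monomial map. -/
lemma le_dim_flagCoset [Infinite K] {m : ℕ} (e : Module.Basis (Fin (m + 1)) ℤ (Fin (m + 1) → ℤ))
    (ζ : Torus K (m + 1)) : (m : WithBot ℕ∞) ≤ dim (flagCoset e ζ 1) := by
  let C := flagCoset e ζ 1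
  let Z : ℕ → TopologicalSpace.IrreducibleCloseds C := fun k =>
    { carrier := Subtype.val ⁻¹' flagCoset e ζ (k + 1)
      isIrreducible' := by
        let τ : Torus K (m + 1) → C := fun y => ⟨substMap ζ (flagProj e (k + 1)) y,
          flagCoset_anti e ζ (by omega) (substMap_flagProj_mem e ζ (k + 1) y)⟩
        have hτ : Continuous τ := (continuous_substMap _ _).subtype_mk _
        have h : (Subtype.val ⁻¹' flagCoset e ζ (k + 1) : Set C) = τ '' Set.univ := by
          ext x
          simp only [Set.image_univ, Set.mem_range, Set.mem_preimage]
          constructor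
          · intro hx
            obtain ⟨y, hy⟩ := exists_substMap_flagProj_eq e ζ (k + 1) hx
            exact ⟨y, Subtype.ext hy⟩
          · rintro ⟨y, rfl⟩
            exact substMap_flagProj_mem e ζ (k + 1) y
        rw [h]
        exact isIrreducible_univ.image _ hτ.continuousOn
      isClosed' := (isClosed_flagCoset e ζ (k + 1)).preimage continuous_subtype_val }
  -- The index is reversed because the flag decreases with `k`.
  have hmono : StrictMono fun i : Fin (m + 1) => Z (m - i) := by
    intro i j hij
    have hij' : (i : ℕ) < j := hij
    have hj := j.2
    refine lt_of_le_not_ge ?_ fun h => ?_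
    · intro x hx
      exact flagCoset_anti e ζ (by omega : m - (j : ℕ) + 1 ≤ m - i + 1) hx
    · obtain ⟨x, hx, hx'⟩ := exists_mem_flagCoset_notMem e ζ
        (by omega : m - (j : ℕ) + 1 < m - i + 1) (by omega)
      exact hx' (h (show (⟨x, flagCoset_anti e ζ (by omega) hx⟩ : C) ∈ Z (m - j) from hx))
  exact Order.LTSeries.length_le_krullDim (LTSeries.mk m _ hmono)

/-! ### Upper bound for the dimension of a hypersurface. -/

/-- The prime ideal of polynomials vanishing on an irreducible subset of the torus. -/
def vanishingPrime (A : Set (Torus K n)) (hA : IsIrreducible A) :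
    PrimeSpectrum (MvPolynomial (Fin n) K) where
  asIdeal :=
    { carrier := {p | ∀ x ∈ A, MvPolynomial.aeval (fun i => (x i : K)) p = 0}
      zero_mem' := by simp
      add_mem' := fun hp hq x hx => by rw [map_add, hp x hx, hq x hx, add_zero]
      smul_mem' := fun c p hp x hx => by rw [smul_eq_mul, map_mul, hp x hx, mul_zero] }
  isPrime := by
    have hemb : ∀ (p : MvPolynomial (Fin n) K) (x : Torus K n),
        eval x (MvPolynomial.aeval (fun i => (AddMonoidAlgebra.single (Pi.single i 1) 1 :
          LaurentRing K n)) p) = MvPolynomial.aeval (fun i => (x i : K)) p := by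
      intro p x
      rw [← AlgHom.comp_apply, MvPolynomial.comp_aeval]
      congr 2
      funext i
      rw [eval_single, one_mul, ← toChar_symm_apply, MulEquiv.symm_apply_apply]
    refine Ideal.isPrime_iff.2 ⟨?_, ?_⟩
    · rw [Ideal.ne_top_iff_one]
      intro h
      obtain ⟨x, hx⟩ := hA.1
      have := h x hx
      rw [map_one] at this
      exact one_ne_zero this
    · intro p q hpq
      have h := isPreirreducible_iff_isClosed_union_isClosed.1 hA.2
        _ _ (isClosed_zeroLocus (MvPolynomial.aeval (fun i => (AddMonoidAlgebra.single
          (Pi.single i 1) 1 : LaurentRing K n)) p)) (isClosed_zeroLocus (MvPolynomial.aeval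
          (fun i => (AddMonoidAlgebra.single (Pi.single i 1) 1 : LaurentRing K n)) q)) ?_
      · refine h.imp (fun h x hx => ?_) fun h x hx => ?_
        · rw [← hemb]
          exact h hx
        · rw [← hemb]
          exact h hx
      · intro x hx
        have := hpq x hx
        rw [map_mul, mul_eq_zero] at this
        refine this.imp (fun h => ?_) fun h => ?_
        · exact (hemb p x).trans h
        · exact (hemb q x).trans h

lemma mem_vanishingPrime {A : Set (Torus K n)} {hA : IsIrreducible A}
    {p : MvPolynomial (Fin n) K} : p ∈ (vanishingPrime A hA).asIdeal ↔
      ∀ x ∈ A, MvPolynomial.aeval (fun i => (x i : K)) p = 0 := Iff.rfl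

lemma exists_mvPolynomial_eval_eq (P : LaurentRing K n) :
    ∃ (p : MvPolynomial (Fin n) K) (u : Torus K n → Kˣ),
      ∀ x, MvPolynomial.aeval (fun i => (x i : K)) p = u x * eval x P := by
  let N : ℕ := ∑ a ∈ P.coeff.support, ∑ i, (a i).natAbs
  have hN : ∀ a ∈ P.coeff.support, ∀ i, (a i).natAbs ≤ N := fun a ha i =>
    (Finset.single_le_sum (f := fun i => (a i).natAbs) (by simp) (Finset.mem_univ i)).trans
      (Finset.single_le_sum (f := fun a : Fin n → ℤ => ∑ i, (a i).natAbs) (by simp) ha)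
  refine ⟨∑ a ∈ P.coeff.support, MvPolynomial.monomial
    (Finsupp.equivFunOnFinite.symm fun i => (a i + N).toNat) (P.coeff a), fun x => ∏ i, x i ^ N,
    fun x => ?_⟩
  rw [eval_eq_charEval, CharTorus.charEval, map_sum, Finset.mul_sum]
  refine Finset.sum_congr rfl fun a ha => ?_
  rw [MvPolynomial.aeval_monomial, Finsupp.prod_fintype _ _ (by simp)]
  have h : ∏ i, (x i : K) ^ (a i + N).toNat = (((∏ i, x i ^ N) * toChar x a : Kˣ) : K) := by
    rw [toChar_apply, ← Finset.prod_mul_distrib, Units.coe_prod]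
    refine Finset.prod_congr rfl fun i _ => ?_
    have := hN a ha i
    rw [← Units.val_pow_eq_pow_val, ← zpow_natCast, ← zpow_natCast, ← zpow_add,
      Int.toNat_of_nonneg (by omega), add_comm]
  simp only [Finsupp.coe_equivFunOnFinite_symm]
  rw [h, Units.val_mul]
  simp only [Algebra.algebraMap_self, RingHom.id_apply]
  ring

/-- Clearing denominators does not change zeros on the torus, so ordinary polynomials already
separate a closed set from the points outside it. -/
lemma vanishingPrime_lt {A B : Set (Torus K n)} {hA : IsIrreducible A} {hB : IsIrreducible B}
    (hAc : IsClosed A) (hAB : A ⊂ B) : vanishingPrime B hB < vanishingPrime A hA := by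
  refine lt_of_le_not_ge (fun p hp x hx => hp x (hAB.1 hx)) fun h => hAB.2 fun x hx => ?_
  obtain ⟨S, rfl⟩ := (isClosed_iff A).1 hAc
  intro P hP
  obtain ⟨p, u, hp⟩ := exists_mvPolynomial_eval_eq P
  have h1 : p ∈ (vanishingPrime B hB).asIdeal := by
    refine h (mem_vanishingPrime.2 fun y hy => ?_)
    rw [hp, hy P hP, mul_zero]
  have h2 := mem_vanishingPrime.1 h1 x hx
  rw [hp] at h2
  exact (mul_eq_zero.1 h2).resolve_left (Units.ne_zero _)

lemma dim_zeroLocus_le [Infinite K] {m : ℕ} (P : LaurentRing K (m + 1)) (hP : P ≠ 0) :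
    dim (zeroLocus P) ≤ m := by
  let X := zeroLocus P
  have hXc : IsClosed X := isClosed_zeroLocus P
  change Order.krullDim (TopologicalSpace.IrreducibleCloseds X) ≤ m
  rcases isEmpty_or_nonempty (TopologicalSpace.IrreducibleCloseds X) with hE | hE
  · rw [Order.krullDim_eq_bot]
    exact bot_le
  have hirr : ∀ Z : TopologicalSpace.IrreducibleCloseds X,
      IsIrreducible (Subtype.val '' (Z : Set X)) := fun Z =>
    Z.isIrreducible.image _ continuous_subtype_val.continuousOn
  have hcl : ∀ Z : TopologicalSpace.IrreducibleCloseds X,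
      IsClosed (Subtype.val '' (Z : Set X)) := fun Z =>
    hXc.isClosedEmbedding_subtypeVal.isClosedMap _ Z.isClosed
  -- Since `P ≠ 0`, the whole torus can be put on top of any chain in the hypersurface. Such chains
  -- therefore have length one less than the Krull dimension `m + 1` of the polynomial ring, at
  -- most.
  let F : WithTop (TopologicalSpace.IrreducibleCloseds X) →
      (PrimeSpectrum (MvPolynomial (Fin (m + 1)) K))ᵒᵈ := fun Z =>
    match Z with
    | ⊤ => OrderDual.toDual (vanishingPrime Set.univ isIrreducible_univ)
    | (Z : TopologicalSpace.IrreducibleCloseds X) => OrderDual.toDual (vanishingPrime _ (hirr Z))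
  have hF : StrictMono F := by
    intro Z Z' h
    induction Z using WithTop.recTopCoe with
    | top => exact absurd h not_top_lt
    | coe Z =>
      induction Z' using WithTop.recTopCoe with
      | top =>
        refine vanishingPrime_lt (hA := hirr Z) (hB := isIrreducible_univ) (hcl Z)
          (Set.ssubset_univ_iff.2 fun hu => hP ?_)
        refine eq_zero_of_forall_eval P fun x => ?_
        obtain ⟨y, -, rfl⟩ : x ∈ Subtype.val '' (Z : Set X) := hu ▸ Set.mem_univ x
        exact y.2
      | coe Z' =>
        refine vanishingPrime_lt (hA := hirr Z) (hB := hirr Z') (hcl Z) ?_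
        have h' : Z < Z' := WithTop.coe_lt_coe.1 h
        exact Subtype.val_injective.image_strictMono (SetLike.coe_ssubset_coe.2 h')
  have h1 := Order.krullDim_le_of_strictMono F hF
  rw [Order.krullDim_WithTop, Order.krullDim_orderDual] at h1
  have h2 : Order.krullDim (PrimeSpectrum (MvPolynomial (Fin (m + 1)) K)) =
      ((m + 1 : ℕ) : WithBot ℕ∞) := by
    have := MvPolynomial.ringKrullDim_of_isNoetherianRing (R := K) (ι := Fin (m + 1))
    rw [ringKrullDim_eq_zero_of_field, zero_add, Nat.card_eq_fintype_card, Fintype.card_fin] at this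
    exact this
  rw [h2, Nat.cast_add, Nat.cast_one] at h1
  exact ENat.WithBot.add_le_add_one_right_iff.1 h1

end Zariski

end Torus

/-! ### From admissibility to the absence of codimension-one torsion cosets. -/

namespace Torus

variable {K : Type*} [Field K] {n : ℕ}

section Zariski

attribute [local instance] zariski

lemma dim_mono {X Y : Set (Torus K n)} (h : X ⊆ Y) : dim X ≤ dim Y :=
  (Topology.IsEmbedding.inclusion h).isInducing.topologicalKrullDim_le

end Zariski

lemma isTorsionCoset_flagCoset [Infinite K] (e : Module.Basis (Fin n) ℤ (Fin n → ℤ)) {ζ : Torus K n}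
    (hζ : IsOfFinOrder ζ) (j : ℕ) : IsTorsionCoset (flagCoset e ζ j) := by
  let G : Subgroup (Torus K n) :=
    { carrier := flagCoset e 1 j
      mul_mem' := fun {x y} hx hy i hi => by
        rw [map_mul, AddChar.mul_apply, hx i hi, hy i hi, map_one, AddChar.one_apply, mul_one]
      one_mem' := fun i _ => rfl
      inv_mem' := fun {x} hx i hi => by
        rw [map_inv, AddChar.inv_apply', hx i hi, map_one, AddChar.one_apply, inv_one] }
  refine ⟨ζ, G, hζ, ⟨isAlgebraicSet_flagCoset e 1 j, isIrreducible_flagCoset e 1 j⟩, ?_⟩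
  ext x
  constructor
  · intro hx
    refine ⟨ζ⁻¹ * x, fun i hi => ?_, by simp⟩
    rw [map_mul, map_inv, AddChar.mul_apply, AddChar.inv_apply', hx i hi, inv_mul_cancel, map_one,
      AddChar.one_apply]
  · rintro ⟨g, hg, rfl⟩ i hi
    have hg' : toChar g (e i) = toChar 1 (e i) := hg i hi
    simp only [map_mul, AddChar.mul_apply, hg', map_one, AddChar.one_apply, mul_one]

/-- `φ a = 1` splits the lattice as `ℤ a ⊕ ker φ`, so a basis of `ker φ` completes `a`. -/
lemma exists_basis_zero_eq {m : ℕ} (a : Fin (m + 1) → ℤ) (φ : (Fin (m + 1) → ℤ) →ₗ[ℤ] ℤ)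
    (hφ : φ a = 1) : ∃ e : Module.Basis (Fin (m + 1)) ℤ (Fin (m + 1) → ℤ), e 0 = a := by
  have hrank : Module.finrank ℤ (LinearMap.ker φ) = m := by
    have := CharTorus.finrank_ker_add_one φ a hφ
    rw [Module.finrank_fin_fun] at this
    omega
  refine ⟨Module.Basis.mkFinCons a (Module.finBasisOfFinrankEq ℤ _ hrank) ?_ ?_, ?_⟩
  · intro c x hx h
    have h1 := congrArg φ h
    rw [map_add, map_smul, hφ, LinearMap.mem_ker.1 hx] at h1
    simpa using h1
  · intro z
    refine ⟨-φ z, ?_⟩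
    rw [LinearMap.mem_ker, map_add, map_smul, hφ]
    simp
  · rw [Module.Basis.coe_mkFinCons, Fin.cons_zero]

lemma mem_zeroLocus_iff_toChar (P : LaurentRing K n) (x : Torus K n) :
    x ∈ zeroLocus P ↔ toChar x ∈ CharTorus.vanishing {P.coeff} := by
  simp [zeroLocus, CharTorus.vanishing, eval_eq_charEval]

/-- A codimension-one torsion coset inside the hypersurface would have its dimension squeezed: `m ≤
dim C ≤ dim (zeroLocus P) ≤ m`. -/
lemma noTorsionCoset_of_dim_ne [Infinite K] {m : ℕ} (P : LaurentRing K (m + 1)) (hP : P ≠ 0)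
    (h : ∀ C : Set (Torus K (m + 1)), IsTorsionCoset C → C ⊆ zeroLocus P →
      dim C ≠ dim (zeroLocus P)) : CharTorus.NoTorsionCoset (CharTorus.vanishing {P.coeff}) := by
  intro a φ hφ ζ hζ
  by_contra! hc
  obtain ⟨e, he⟩ := exists_basis_zero_eq a φ hφ
  have hζ' : IsOfFinOrder (toChar.symm ζ) := toChar.symm.toMonoidHom.isOfFinOrder hζ
  have hsub : flagCoset e (toChar.symm ζ) 1 ⊆ zeroLocus P := by
    intro x hx
    rw [mem_zeroLocus_iff_toChar]
    apply hc
    have := hx 0 (by simp)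
    rwa [MulEquiv.apply_symm_apply, he] at this
  exact h _ (isTorsionCoset_flagCoset e hζ' 1) hsub
    (le_antisymm (dim_mono hsub) ((dim_zeroLocus_le P hP).trans (le_dim_flagCoset e _)))

lemma image_toChar_torsionUpTo (P : LaurentRing K n) {T : ℝ} (hT : 0 ≤ T) :
    toChar '' torsionUpTo (zeroLocus P) T =
      CharTorus.torsionZeros (CharTorus.vanishing {P.coeff}) ⌊T⌋₊ := by
  ext χ
  constructor
  · rintro ⟨x, ⟨h1, h2, h3⟩, rfl⟩
    refine ⟨(mem_zeroLocus_iff_toChar P x).1 h1, toChar.toMonoidHom.isOfFinOrder h2, ?_⟩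
    rw [MulEquiv.orderOf_eq]
    exact Nat.le_floor h3
  · rintro ⟨h1, h2, h3⟩
    refine ⟨toChar.symm χ, ⟨?_, toChar.symm.toMonoidHom.isOfFinOrder h2, ?_⟩, by simp⟩
    · rwa [mem_zeroLocus_iff_toChar, MulEquiv.apply_symm_apply]
    · rw [MulEquiv.orderOf_eq]
      exact (Nat.le_floor_iff hT).1 h3

end Torus

theorem theorem6 {K : Type*} [Field K] [IsAlgClosed K] {n : ℕ} (hn : 2 ≤ n)
    (X : Set (Torus K n)) (hX : Torus.IsHypersurface X) (hadm : Torus.IsAdmissible X) :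
    ∃ c : ℝ, 0 < c ∧ ∀ T : ℝ, 1 ≤ T →
      (Torus.torsionUpTo X T).Finite ∧
        ((Torus.torsionUpTo X T).ncard : ℝ) ≤ c * T ^ ((n : ℝ) - 1 / (n : ℝ)) := by
  have : Infinite K := IsAlgClosed.instInfinite
  have hexp : (0 : ℝ) ≤ (n : ℝ) - 1 / (n : ℝ) := by
    have h1 : (2 : ℝ) ≤ n := by exact_mod_cast hn
    have h2 : 1 / (n : ℝ) ≤ 1 := by
      rw [div_le_one (by linarith)]
      linarith
    linarith
  obtain ⟨P, hP, -, rfl⟩ := hX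
  rcases hadm.2 with hfin | ⟨-, hC⟩
  · refine ⟨(Torus.zeroLocus P).ncard + 1, by positivity, fun T hT => ?_⟩
    have hsub : Torus.torsionUpTo (Torus.zeroLocus P) T ⊆ Torus.zeroLocus P := fun x hx => hx.1
    refine ⟨hfin.subset hsub, ?_⟩
    have h1 : ((Torus.torsionUpTo (Torus.zeroLocus P) T).ncard : ℝ) ≤ (Torus.zeroLocus P).ncard := by
      exact_mod_cast Set.ncard_le_ncard hsub hfin
    have h2 : 1 ≤ T ^ ((n : ℝ) - 1 / (n : ℝ)) := Real.one_le_rpow hT hexp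
    have h3 : (0 : ℝ) ≤ (Torus.zeroLocus P).ncard := by positivity
    nlinarith
  · obtain ⟨m, rfl⟩ : ∃ m, n = m + 1 := ⟨n - 1, by omega⟩
    obtain ⟨c, hc⟩ := CharTorus.exists_ncard_torsionZeros_le hn (Module.finrank_fin_fun ℤ)
      {P.coeff} (Torus.noTorsionCoset_of_dim_ne P hP hC)
    -- The sign of `c` is unknown, and the constant must be positive.
    refine ⟨|c| + 1, by positivity, fun T hT => ?_⟩
    have hT0 : 0 ≤ T := by linarith
    have himg := Torus.image_toChar_torsionUpTo P hT0
    refine ⟨Set.Finite.of_finite_image (himg ▸ CharTorus.finite_torsionZeros _ _)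
      Torus.toChar.injective.injOn, ?_⟩
    rw [← Set.ncard_image_of_injective _ Torus.toChar.injective, himg]
    have h1 : ((⌊T⌋₊ : ℕ) : ℝ) ^ (((m + 1 : ℕ) : ℝ) - 1 / ((m + 1 : ℕ) : ℝ)) ≤
        T ^ (((m + 1 : ℕ) : ℝ) - 1 / ((m + 1 : ℕ) : ℝ)) :=
      Real.rpow_le_rpow (by positivity) (Nat.floor_le hT0) hexp
    refine (hc _).trans (mul_le_mul ?_ h1 (by positivity) (by positivity))
    linarith [le_abs_self c]
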